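/- For all reals $0<\delta'\le d<1$ there exist reals $\delta_0,\delta,\varepsilon$ with $\delta'\ge\delta_0>\delta>\varepsilon>0$ and a constant $C>0$ such that the following holds. Let $U,V,W$ be pairwise disjoint finite sets with $|V|=n$, $(1-\delta_0)n\le|U|=|W|\le(1-\delta)n$ and $|U|+|V|+|W|\equiv 0\pmod 3$. Let $G$ be a graph with vertex set $U\cup V\cup W$ in which the pairs $(V,U)$ and $(V,W)$ are both $(\varepsilon,d)$-super-regular, and let $C/n\le p\le 1$. Let $G(V,p)$ be the binomial random graph on $V$ (each pair of vertices of $V$ is an edge independently with probability $p$) and let $G(U,W,p)$ be the random bipartite graph between $U$ and $W$ (each pair in $U\times W$ is an edge independently with probability $p$), independent of $G(V,p)$. Then, asymptotically almost surely as $n\to\infty$, the graph $G\cup G(V,p)\cup G(U,W,p)$ contains a triangle-factor; that is, for every $\eta>0$ there is an $N$ (depending only on $\eta$ and the constants above) such that for all $n\ge N$ and all such $U,V,W,G,p$ the probability of this event is at least $1-\eta$. Here a pair $(A,B)$ of disjoint vertex sets of $G$ is $(\varepsilon,d)$-super-regular if the density $e(X,Y)/(|X||Y|)$ is at least $d$ for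 all $X\subseteq A$, $Y\subseteq B$ with $|X|\ge\varepsilon|A|$ and $|Y|\ge\varepsilon|B|$, every $a\in A$ has at least $d|B|$ neighbours in $B$, and every $b\in B$ has at least $d|A|$ neighbours in $A$. A triangle-factor of a graph on $m$ vertices is a family of $\lfloor m/3\rfloor$ pairwise vertex-disjoint triangles. -/

import Mathlib

open MeasureTheory ProbabilityTheory

namespace TriangleFactor

/-- The pair `(A, B)` of vertex sets is `(ε, d)`-super-regular in `G`: all `X ⊆ A`, `Y ⊆ B` with
`|X| ≥ ε|A|`, `|Y| ≥ ε|B|` have density `e(X, Y) / (|X||Y|) ≥ d`, every vertex of `A` has at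
least `d|B|` neighbours in `B`, and every vertex of `B` has at least `d|A|` neighbours in `A`. -/
def IsSuperRegular {α : Type*} [DecidableEq α] (G : SimpleGraph α) [DecidableRel G.Adj]
    (ε d : ℝ) (A B : Finset α) : Prop :=
  (∀ X ⊆ A, ∀ Y ⊆ B, ε * (A.card : ℝ) ≤ (X.card : ℝ) → ε * (B.card : ℝ) ≤ (Y.card : ℝ) →
    d ≤ (G.edgeDensity X Y : ℝ)) ∧
  (∀ a ∈ A, d * (B.card : ℝ) ≤ ((B.filter (fun b => G.Adj a b)).card : ℝ)) ∧
  (∀ b ∈ B, d * (A.card : ℝ) ≤ ((A.filter (fun a => G.Adj b a)).card : ℝ))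

/-- `G` contains `⌊v(G)/3⌋` pairwise vertex-disjoint triangles. -/
def HasTriangleFactor {α : Type*} [Fintype α] (G : SimpleGraph α) : Prop :=
  ∃ T : Finset (Finset α), (∀ t ∈ T, G.IsNClique 3 t) ∧
    (∀ s ∈ T, ∀ t ∈ T, s ≠ t → Disjoint s t) ∧ T.card = Fintype.card α / 3

/-- The complete graph on the vertex set `A` (the other vertices are isolated). -/
def completeOn {α : Type*} (A : Finset α) : SimpleGraph α :=
  SimpleGraph.fromRel (fun x y => x ∈ A ∧ y ∈ A)

/-- The complete bipartite graph between the (disjoint) sets `A` and `B`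
(the other vertices are isolated). -/
def completeBetween {α : Type*} (A B : Finset α) : SimpleGraph α :=
  SimpleGraph.fromRel (fun x y => x ∈ A ∧ y ∈ B)

/-- The law of the random subgraph of `H` that keeps each edge of `H` independently with
probability `p`. -/
noncomputable def randomSubgraph {α : Type*} (H : SimpleGraph α) (p : unitInterval) :
    Measure (SimpleGraph α) :=
  (setBernoulli H.edgeSet p).map SimpleGraph.fromEdgeSet

/-- The law of the binomial random graph `G(A, p)` on the vertex set `A`. -/
noncomputable def randomOn {α : Type*} (A : Finset α) (p : unitInterval) :
    Measure (SimpleGraph α) :=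
  randomSubgraph (completeOn A) p

/-- The law of the random bipartite graph `G(A, B, p)` between `A` and `B`. -/
noncomputable def randomBetween {α : Type*} (A B : Finset α) (p : unitInterval) :
    Measure (SimpleGraph α) :=
  randomSubgraph (completeBetween A B) p

end TriangleFactor

/-! Write |U| = |W| = m and |V| = n = m + 3b. Then b is a small but linear fraction of n, and a
factor consists of m + b triangles. The random edges between U and W contain an almost perfect
matching M, whose edges are to be completed to triangles by distinct vertices of V through Hall's
theorem. Super-regularity makes almost all pairs in U × W have at least d²|Y| common neighbours in
any given large Y ⊆ V (`card_badPairs_le`), which provides the expansion for Hall's condition; M is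
chosen to avoid the pairs that are bad for Y = V.

Two defects need repair. Fewer than βn vertices of V see too few edges of M; they are first covered
greedily by triangles with one vertex in each of U and W. The vertices of U and W outside the
trimmed matching, exactly b on each side, are covered by triangles that use a random edge inside V.
These 2b triangles consume 4b vertices of V, and this makes the remaining part of V exactly as large
as the trimmed matching. The whole deterministic argument is `containsTriangles_of_pseudorandom`.

It needs three properties of the random graphs: large subsets of V contain an edge, large subsets of
U and W span an edge that is not bad, and for every large Y few bad pairs are edges. Each follows
from a union bound over exponentially many sets, won by choosing C large and then ε small. The third
property is decreasing, so it is established at density exactly C/n and carried to larger p as a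
property of some subgraph (`randomBetween_real_exists_pseudorandom_ge`). -/

namespace TriangleFactor

/-! ### Bernoulli random sets: monotone coupling and tail bounds -/

section SetBernoulli

variable {ι : Type*}

/-- A Bernoulli random subset of `u` arises by keeping `i ∈ u` when an independent uniform
label at `i` is at most `p`. -/
lemma setBernoulli_eq_map_uniform (u : Set ι) (p : unitInterval) :
    setBernoulli u p = (Measure.infinitePi fun _ : ι ↦ (volume : Measure unitInterval)).map
      (fun x ↦ {i | i ∈ u ∧ x i ≤ p}) := by
  have hm : ∀ i : ι, Measurable fun t : unitInterval ↦ (i ∈ u ∧ t ≤ p) := fun i ↦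
    Measurable.and measurable_const (measurableSet_Iic (a := p)).mem
  have hone : ∀ i : ι, (volume : Measure unitInterval).map (fun t ↦ (i ∈ u ∧ t ≤ p)) =
      unitInterval.toNNReal p • Measure.dirac (i ∈ u) +
        unitInterval.toNNReal (unitInterval.symm p) • Measure.dirac False := by
    intro i
    refine Measure.ext_of_singleton fun a ↦ ?_
    have e1 : ((unitInterval.toNNReal p : NNReal) : ENNReal) = ENNReal.ofReal p := by
      rw [ENNReal.ofReal, Real.toNNReal_of_nonneg p.2.1]; rfl
    have e2 : ((unitInterval.toNNReal (unitInterval.symm p) : NNReal) : ENNReal) =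
        ENNReal.ofReal (1 - p) := by
      rw [ENNReal.ofReal, Real.toNNReal_of_nonneg (sub_nonneg.2 p.2.2)]; rfl
    have h1 : {t : unitInterval | t ≤ p} = Set.Iic p := rfl
    have h2 : {t : unitInterval | p < t} = Set.Ioi p := rfl
    -- Needed for i outside `u`, where both atoms sit at `False`.
    have h3 : ENNReal.ofReal p + ENNReal.ofReal (1 - p) = 1 := by
      rw [← ENNReal.ofReal_add p.2.1 (sub_nonneg.2 p.2.2)]; simp
    rw [Measure.map_apply (hm i) (measurableSet_singleton a)]
    simp only [Measure.add_apply, Measure.smul_apply, Measure.dirac_apply, ENNReal.smul_def, e1, e2,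
      smul_eq_mul]
    by_cases hi : i ∈ u <;> by_cases ha : a <;>
      simp [hi, ha, Set.preimage, h1, h2, unitInterval.volume_Iic, unitInterval.volume_Ioi, h3]
  rw [setBernoulli_eq_map]
  have := Measure.infinitePi_map_pi (μ := fun _ : ι ↦ (volume : Measure unitInterval)) hm
  simp_rw [hone] at this
  have hm' : Measurable fun (x : ι → unitInterval) (i : ι) ↦ (i ∈ u ∧ x i ≤ p) :=
    measurable_pi_lambda _ fun i ↦ (hm i).comp (measurable_pi_apply i)
  rw [← this, Measure.map_map (by fun_prop) hm']
  rfl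

lemma measurable_uniform_set (u : Set ι) (p : unitInterval) :
    Measurable (fun x : ι → unitInterval ↦ {i | i ∈ u ∧ x i ≤ p}) := by
  refine measurable_set_iff.2 fun i ↦ ?_
  exact Measurable.and measurable_const
    (((measurableSet_Iic (a := p)).mem).comp (measurable_pi_apply i))

variable [Finite ι]

lemma measurableSet_of_finite (A : Set (Set ι)) : MeasurableSet A :=
  (Set.toFinite A).measurableSet

/-- Monotone coupling: the probability of an increasing family grows with the density. -/
lemma setBernoulli_real_mono (u : Set ι) {p q : unitInterval} (hqp : q ≤ p) {A : Set (Set ι)}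
    (hA : ∀ s ∈ A, ∀ t, s ⊆ t → t ∈ A) :
    (setBernoulli u q).real A ≤ (setBernoulli u p).real A := by
  rw [setBernoulli_eq_map_uniform u p, setBernoulli_eq_map_uniform u q,
    map_measureReal_apply (measurable_uniform_set u q) (measurableSet_of_finite A),
    map_measureReal_apply (measurable_uniform_set u p) (measurableSet_of_finite A)]
  refine measureReal_mono fun x hx ↦ hA _ hx _ fun i hi ↦ ⟨hi.1, hi.2.trans hqp⟩

lemma setBernoulli_real_superset {u : Set ι} (p : unitInterval) {T : Finset ι}
    (hT : (T : Set ι) ⊆ u) :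
    (setBernoulli u p).real {s | (T : Set ι) ⊆ s} = (p : ℝ) ^ T.card := by
  rw [setBernoulli_eq_map_uniform u p,
    map_measureReal_apply (measurable_uniform_set u p) (measurableSet_of_finite _)]
  have : (fun x : ι → unitInterval ↦ {i | i ∈ u ∧ x i ≤ p}) ⁻¹' {s | (T : Set ι) ⊆ s} =
      Set.pi (T : Set ι) fun _ ↦ Set.Iic p := by
    ext x
    simp only [Set.mem_preimage, Set.mem_ofPred_eq, Set.subset_def, Set.mem_pi, Set.mem_Iic]
    exact ⟨fun h i hi ↦ (h i hi).2, fun h i hi ↦ ⟨hT hi, h i hi⟩⟩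
  rw [this, measureReal_def, Measure.infinitePi_pi _ (fun _ _ ↦ measurableSet_Iic)]
  simp [unitInterval.volume_Iic, ENNReal.toReal_ofReal p.2.1]

lemma setBernoulli_real_disjoint {u : Set ι} (p : unitInterval) {T : Finset ι}
    (hT : (T : Set ι) ⊆ u) :
    (setBernoulli u p).real {s | ∀ i ∈ T, i ∉ s} = (1 - (p : ℝ)) ^ T.card := by
  rw [setBernoulli_eq_map_uniform u p,
    map_measureReal_apply (measurable_uniform_set u p) (measurableSet_of_finite _)]
  have : (fun x : ι → unitInterval ↦ {i | i ∈ u ∧ x i ≤ p}) ⁻¹' {s | ∀ i ∈ T, i ∉ s} =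
      Set.pi (T : Set ι) fun _ ↦ Set.Ioi p := by
    ext x
    simp only [Set.mem_preimage, Set.mem_ofPred_eq, Set.mem_pi, Set.mem_Ioi]
    exact ⟨fun h i hi ↦ not_le.1 fun h' ↦ h i hi ⟨hT hi, h'⟩,
      fun h i hi h' ↦ (h i hi).not_ge h'.2⟩
  rw [this, measureReal_def, Measure.infinitePi_pi _ (fun _ _ ↦ measurableSet_Ioi)]
  simp [unitInterval.volume_Ioi, ENNReal.toReal_ofReal (sub_nonneg.2 p.2.2)]

lemma setBernoulli_real_disjoint_le {u : Set ι} (p : unitInterval) {T : Finset ι}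
    (hT : (T : Set ι) ⊆ u) :
    (setBernoulli u p).real {s | ∀ i ∈ T, i ∉ s} ≤ Real.exp (-(p * T.card)) := by
  rw [setBernoulli_real_disjoint p hT]
  calc (1 - (p : ℝ)) ^ T.card ≤ (Real.exp (-p)) ^ T.card := by
        gcongr
        · linarith [p.2.2]
        · linarith [Real.add_one_le_exp (-(p : ℝ))]
    _ = _ := by rw [← Real.exp_nat_mul]; congr 1; ring

/-- Upper tail bound for the number of elements of `S` in a Bernoulli random set. -/
lemma setBernoulli_real_card_ge_le {κ : Type*} [DecidableEq κ] {u : Set ι} (p : unitInterval)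
    (S : Finset κ) (φ : κ → ι) (hφ : Set.InjOn φ S) (hu : ∀ a ∈ S, φ a ∈ u) (k : ℕ) {t : ℝ}
    (ht : 0 < t) :
    (setBernoulli u p).real {s | ∃ T ⊆ S, T.card = k ∧ ∀ a ∈ T, φ a ∈ s} ≤
      Real.exp (S.card * p * t) / t ^ k := by
  classical
  have hsub : {s : Set ι | ∃ T ⊆ S, T.card = k ∧ ∀ a ∈ T, φ a ∈ s} ⊆
      ⋃ T ∈ S.powersetCard k, {s | ((T.image φ : Finset ι) : Set ι) ⊆ s} := by
    rintro s ⟨T, hTS, hTk, h⟩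
    simp only [Set.mem_iUnion]
    refine ⟨T, Finset.mem_powersetCard.2 ⟨hTS, hTk⟩, ?_⟩
    intro i hi
    obtain ⟨a, ha, rfl⟩ := Finset.mem_image.1 (Finset.mem_coe.1 hi)
    exact h a ha
  have hp := p.2.1
  calc _ ≤ _ := measureReal_mono hsub (measure_ne_top _ _)
    _ ≤ ∑ T ∈ S.powersetCard k,
        (setBernoulli u p).real {s | ((T.image φ : Finset ι) : Set ι) ⊆ s} :=
      measureReal_biUnion_finset_le _ _
    _ = ∑ T ∈ S.powersetCard k, (p : ℝ) ^ k := by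
      refine Finset.sum_congr rfl fun T hT ↦ ?_
      obtain ⟨hTS, hTk⟩ := Finset.mem_powersetCard.1 hT
      rw [setBernoulli_real_superset, Finset.card_image_of_injOn (hφ.mono hTS), hTk]
      intro i hi
      obtain ⟨a, ha, rfl⟩ := Finset.mem_image.1 (Finset.mem_coe.1 hi)
      exact hu a (hTS ha)
    _ = (S.card.choose k : ℝ) * (p : ℝ) ^ k := by
      rw [Finset.sum_const, Finset.card_powersetCard, nsmul_eq_mul]
    _ ≤ ((S.card : ℝ) ^ k / k.factorial) * (p : ℝ) ^ k := by
      gcongr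
      exact Nat.choose_le_pow_div k S.card
    -- The free parameter t is inserted so that a single term of the exponential series bounds the
    -- numerator, as in a Chernoff bound.
    _ = ((S.card * p * t) ^ k / k.factorial) / t ^ k := by
      rw [mul_pow, mul_pow]
      field_simp
    _ ≤ _ := by
      gcongr
      exact Real.pow_div_factorial_le_exp _ (by positivity) k

end SetBernoulli

/-! ### Disjoint triangles, greedy covering and large matchings -/

section Deterministic

variable {α : Type*}

/-- `S` contains `k` pairwise disjoint triangles of `H`. -/
def ContainsTriangles (H : SimpleGraph α) (k : ℕ) (S : Finset α) : Prop :=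
  ∃ T : Finset (Finset α), (∀ t ∈ T, H.IsNClique 3 t ∧ t ⊆ S) ∧
    (∀ s ∈ T, ∀ t ∈ T, s ≠ t → Disjoint s t) ∧ T.card = k

lemma ContainsTriangles.mono {H : SimpleGraph α} {k : ℕ} {S S' : Finset α}
    (h : ContainsTriangles H k S) (hS : S ⊆ S') : ContainsTriangles H k S' := by
  obtain ⟨T, hT, hTd, hk⟩ := h
  exact ⟨T, fun t ht ↦ ⟨(hT t ht).1, (hT t ht).2.trans hS⟩, hTd, hk⟩

lemma ContainsTriangles.hasTriangleFactor [Fintype α] {H : SimpleGraph α} {S : Finset α} {k : ℕ}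
    (h : ContainsTriangles H k S) (hk : k = Fintype.card α / 3) : HasTriangleFactor H := by
  obtain ⟨T, hT, hTd, hk'⟩ := h
  exact ⟨T, fun t ht ↦ (hT t ht).1, hTd, hk'.trans hk⟩

variable [DecidableEq α]

lemma ContainsTriangles.union {H : SimpleGraph α} {k l : ℕ} {S S' : Finset α}
    (h : ContainsTriangles H k S) (h' : ContainsTriangles H l S') (hd : Disjoint S S') :
    ContainsTriangles H (k + l) (S ∪ S') := by
  obtain ⟨T, hT, hTd, rfl⟩ := h
  obtain ⟨T', hT', hTd', rfl⟩ := h'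
  have key : ∀ s ∈ T, ∀ t ∈ T', Disjoint s t := fun s hs t ht ↦
    hd.mono (hT s hs).2 (hT' t ht).2
  refine ⟨T ∪ T', ?_, ?_, ?_⟩
  · intro t ht
    rcases Finset.mem_union.1 ht with ht | ht
    · exact ⟨(hT t ht).1, (hT t ht).2.trans Finset.subset_union_left⟩
    · exact ⟨(hT' t ht).1, (hT' t ht).2.trans Finset.subset_union_right⟩
  · intro s hs t ht hst
    rcases Finset.mem_union.1 hs with hs | hs <;> rcases Finset.mem_union.1 ht with ht | ht
    · exact hTd s hs t ht hst
    · exact key s hs t ht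
    · exact (key t ht s hs).symm
    · exact hTd' s hs t ht hst
  · refine Finset.card_union_of_disjoint (Finset.disjoint_left.2 fun t ht ht' ↦ ?_)
    -- A triangle lying in both families would be disjoint from itself, hence empty.
    have := (hT t ht).1.card_eq
    have h0 := key t ht t ht'
    rw [disjoint_self, Finset.bot_eq_empty] at h0
    simp [h0] at this

lemma containsTriangles_biUnion {ι : Type*} {H : SimpleGraph α} (J : Finset ι)
    (f : ι → Finset α) (hf : ∀ j ∈ J, H.IsNClique 3 (f j))
    (hd : ∀ i ∈ J, ∀ j ∈ J, i ≠ j → Disjoint (f i) (f j)) :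
    ContainsTriangles H J.card (J.biUnion f) := by
  classical
  induction J using Finset.induction_on with
  | empty => exact ⟨∅, by simp, by simp, by simp⟩
  | insert a J ha ih =>
    have h1 := ih (fun j hj ↦ hf j (Finset.mem_insert_of_mem hj))
      (fun i hi j hj ↦ hd i (Finset.mem_insert_of_mem hi) j (Finset.mem_insert_of_mem hj))
    have h2 : ContainsTriangles H 1 (f a) :=
      ⟨{f a}, by simpa using hf a (Finset.mem_insert_self _ _), by simp, by simp⟩
    have h3 := h2.union h1 (by
      rw [Finset.disjoint_biUnion_right]
      intro j hj
      exact hd a (Finset.mem_insert_self _ _) j (Finset.mem_insert_of_mem hj)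
        (fun h ↦ ha (h ▸ hj)))
    rw [Finset.card_insert_of_notMem ha, Finset.biUnion_insert, add_comm]
    exact h3

/-- Greedy embedding: if every `i ∈ I` forms triangles with many vertices of `A₁` and `A₂`, then
disjoint triangles through all vertices of `I` exist. -/
lemma exists_containsTriangles_greedy {H : SimpleGraph α} (I A₁ A₂ : Finset α)
    (h₁ : Disjoint I A₁) (h₂ : Disjoint I A₂)
    (h : ∀ i ∈ I, ∀ Z : Finset α, Z.card ≤ 2 * I.card →
      ∃ x ∈ A₁ \ Z, ∃ y ∈ A₂ \ Z, H.IsNClique 3 {i, x, y}) :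
    ∃ D₁ ⊆ A₁, ∃ D₂ ⊆ A₂, Disjoint D₁ D₂ ∧ D₁.card = I.card ∧ D₂.card = I.card ∧
      ContainsTriangles H I.card (I ∪ (D₁ ∪ D₂)) := by
  induction I using Finset.induction_on with
  | empty =>
    exact ⟨∅, by simp, ∅, by simp, by simp, by simp, by simp, ∅, by simp, by simp, by simp⟩
  | insert a I ha ih =>
    rw [Finset.disjoint_insert_left] at h₁ h₂
    obtain ⟨D₁, hD₁, D₂, hD₂, hD, hc₁, hc₂, hT⟩ := ih h₁.2 h₂.2 (fun i hi Z hZ ↦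
      h i (Finset.mem_insert_of_mem hi) Z (hZ.trans (by
        rw [Finset.card_insert_of_notMem ha]; omega)))
    -- The forbidden set consists of the vertices of A₁ and A₂ already used, two for each earlier
    -- triangle. A₁ and A₂ may coincide, so both parts are excluded on both sides.
    obtain ⟨x, hx, y, hy, hxy⟩ := h a (Finset.mem_insert_self _ _) (D₁ ∪ D₂) (by
      rw [Finset.card_insert_of_notMem ha, Finset.card_union_of_disjoint hD]; omega)
    simp only [Finset.mem_sdiff, Finset.mem_union, not_or] at hx hy
    have hne : H.Adj a x ∧ H.Adj a y ∧ H.Adj x y := SimpleGraph.is3Clique_triple_iff.1 hxy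
    have hxny := hne.2.2.ne
    refine ⟨insert x D₁, Finset.insert_subset hx.1 hD₁, insert y D₂,
      Finset.insert_subset hy.1 hD₂, ?_, ?_, ?_, ?_⟩
    · rw [Finset.disjoint_insert_left, Finset.disjoint_insert_right, Finset.mem_insert, not_or]
      exact ⟨⟨hxny, hx.2.2⟩, hy.2.1, hD⟩
    · rw [Finset.card_insert_of_notMem hx.2.1, Finset.card_insert_of_notMem ha, hc₁]
    · rw [Finset.card_insert_of_notMem hy.2.2, Finset.card_insert_of_notMem ha, hc₂]
    · have h2 : ContainsTriangles H 1 {a, x, y} := ⟨{{a, x, y}}, by simpa using hxy, by simp, by simp⟩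
      have hI₁ := Finset.disjoint_left.1 h₁.2
      have hI₂ := Finset.disjoint_left.1 h₂.2
      have h3 := hT.union h2 (by
        simp only [Finset.disjoint_insert_right, Finset.disjoint_singleton_right, Finset.mem_union,
          not_or]
        exact ⟨⟨ha, fun h ↦ h₁.1 (hD₁ h), fun h ↦ h₂.1 (hD₂ h)⟩,
          ⟨fun h ↦ hI₁ h hx.1, hx.2⟩, ⟨fun h ↦ hI₂ h hy.1, hy.2⟩⟩)
      rw [Finset.card_insert_of_notMem ha]
      refine h3.mono fun z hz ↦ ?_
      simp only [Finset.mem_union, Finset.mem_insert, Finset.mem_singleton] at hz ⊢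
      tauto

/-- A bipartite graph in which any two large sets span an edge has an almost perfect matching. -/
lemma exists_large_matching (r : α → α → Prop) (U W : Finset α) (hUW : U.card = W.card) (b : ℝ)
    (h : ∀ X ⊆ U, ∀ Z ⊆ W, b ≤ X.card → b ≤ Z.card → ∃ x ∈ X, ∃ z ∈ Z, r x z) :
    ∃ M ⊆ U ×ˢ W, (∀ q ∈ M, r q.1 q.2) ∧ Set.InjOn Prod.fst (M : Set (α × α)) ∧
      Set.InjOn Prod.snd (M : Set (α × α)) ∧ (U.card : ℝ) - b < M.card := by
  classical
  let 𝓜 : Finset (Finset (α × α)) := (U ×ˢ W).powerset.filter fun M ↦ (∀ q ∈ M, r q.1 q.2) ∧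
    Set.InjOn Prod.fst (M : Set (α × α)) ∧ Set.InjOn Prod.snd (M : Set (α × α))
  have hne : 𝓜.Nonempty := ⟨∅, by simp [𝓜]⟩
  obtain ⟨M, hM, hmax⟩ := Finset.exists_max_image 𝓜 Finset.card hne
  simp only [𝓜, Finset.mem_filter, Finset.mem_powerset] at hM hmax
  obtain ⟨hMs, hMr, h₁, h₂⟩ := hM
  refine ⟨M, hMs, hMr, h₁, h₂, ?_⟩
  by_contra! hlt
  have s₁ : M.image Prod.fst ⊆ U := Finset.image_subset_iff.2 fun q hq ↦
    (Finset.mem_product.1 (hMs hq)).1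
  have s₂ : M.image Prod.snd ⊆ W := Finset.image_subset_iff.2 fun q hq ↦
    (Finset.mem_product.1 (hMs hq)).2
  have c₁ := Finset.card_sdiff_add_card_eq_card s₁
  have c₂ := Finset.card_sdiff_add_card_eq_card s₂
  rw [Finset.card_image_of_injOn h₁] at c₁
  rw [Finset.card_image_of_injOn h₂] at c₂
  have c₁' : ((U \ M.image Prod.fst).card : ℝ) + M.card = U.card := by exact_mod_cast c₁
  have c₂' : ((W \ M.image Prod.snd).card : ℝ) + M.card = W.card := by exact_mod_cast c₂
  have hUW' : (U.card : ℝ) = W.card := by exact_mod_cast hUW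
  -- A maximum matching that leaves at least b vertices uncovered on each side can be extended by an
  -- edge between the uncovered sets.
  obtain ⟨x, hx, z, hz, hxz⟩ := h (U \ M.image Prod.fst) Finset.sdiff_subset
    (W \ M.image Prod.snd) Finset.sdiff_subset (by linarith) (by linarith)
  rw [Finset.mem_sdiff] at hx hz
  have hxM : ∀ q ∈ M, q.1 ≠ x := fun q hq e ↦ hx.2 (Finset.mem_image.2 ⟨q, hq, e⟩)
  have hzM : ∀ q ∈ M, q.2 ≠ z := fun q hq e ↦ hz.2 (Finset.mem_image.2 ⟨q, hq, e⟩)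
  have hnot : (x, z) ∉ M := fun hq ↦ hxM _ hq rfl
  have := hmax (insert (x, z) M) ⟨Finset.insert_subset (Finset.mem_product.2 ⟨hx.1, hz.1⟩) hMs, by
      simpa [hxz] using hMr, by
      rw [Finset.coe_insert, Set.injOn_insert (by simpa using hnot)]
      exact ⟨h₁, by rintro ⟨q, hq, e⟩; exact hxM q hq e⟩, by
      rw [Finset.coe_insert, Set.injOn_insert (by simpa using hnot)]
      exact ⟨h₂, by rintro ⟨q, hq, e⟩; exact hzM q hq e⟩⟩
  rw [Finset.card_insert_of_notMem hnot] at this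
  omega

/-! ### Common neighbourhoods in super-regular pairs -/

/-- The vertices of `Y` that form a triangle with the pair `q` (if `q` becomes an edge). -/
def commonNbrs (G : SimpleGraph α) [DecidableRel G.Adj] (Y : Finset α) (q : α × α) : Finset α :=
  Y.filter fun y ↦ G.Adj y q.1 ∧ G.Adj y q.2

/-- The pairs of `U × W` with fewer than `d² |Y|` common neighbours in `Y`. -/
noncomputable def badPairs (G : SimpleGraph α) [DecidableRel G.Adj] (d : ℝ) (U W Y : Finset α) :
    Finset (α × α) :=
  (U ×ˢ W).filter fun q ↦ ((commonNbrs G Y q).card : ℝ) < d ^ 2 * Y.card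

variable {G : SimpleGraph α} [DecidableRel G.Adj]

/-- In a super-regular pair few vertices have atypically small degree into a large set. -/
lemma card_low_degree_le {ε d : ℝ} {V U Y : Finset α} (h : IsSuperRegular G ε d V U)
    (hε : 0 < ε) (hU : 0 < U.card) (hY : Y ⊆ V) (hYc : ε * V.card ≤ Y.card) :
    ((U.filter fun u ↦ ((Y.filter fun y ↦ G.Adj y u).card : ℝ) < d * Y.card).card : ℝ) ≤
      ε * U.card := by
  set B := U.filter fun u ↦ ((Y.filter fun y ↦ G.Adj y u).card : ℝ) < d * Y.card with hB
  -- If the exceptional set were larger, regularity would apply to it and Y, while summing its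
  -- degrees gives density below d.
  by_contra! hlt
  have hd := h.1 Y hY B (Finset.filter_subset _ _) hYc hlt.le
  have hBpos : (0 : ℝ) < B.card := lt_of_le_of_lt (by positivity) hlt
  have hBne : B.Nonempty := by
    rw [← Finset.card_pos]; exact_mod_cast hBpos
  have hYpos : (0 : ℝ) < Y.card := by
    obtain ⟨u, hu⟩ := hBne
    have h1 := (Finset.mem_filter.1 hu).2
    rcases (Nat.cast_nonneg Y.card : (0 : ℝ) ≤ Y.card).eq_or_lt with h0 | h0
    · rw [← h0, mul_zero] at h1
      exact absurd h1 (not_lt.2 (Nat.cast_nonneg _))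
    · exact h0
  have hcount : ((G.interedges Y B).card : ℝ) =
      ∑ u ∈ B, ((Y.filter fun y ↦ G.Adj y u).card : ℝ) := by
    have : (G.interedges Y B).card = ∑ u ∈ B, (Y.filter fun y ↦ G.Adj y u).card := by
      simp only [SimpleGraph.interedges, Rel.interedges, Finset.card_filter,
        Finset.sum_product_right]
    rw [this]; push_cast; rfl
  have hlt2 : ((G.interedges Y B).card : ℝ) < d * (Y.card * B.card) := by
    rw [hcount]
    calc _ < ∑ u ∈ B, d * (Y.card : ℝ) :=
          Finset.sum_lt_sum_of_nonempty hBne fun u hu ↦ (Finset.mem_filter.1 hu).2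
      _ = _ := by rw [Finset.sum_const, nsmul_eq_mul]; ring
  rw [SimpleGraph.edgeDensity_def] at hd
  push_cast at hd
  rw [le_div_iff₀ (by positivity)] at hd
  linarith

/-- In a bad pair (u, w), either u has low degree into Y, or w has low degree into the neighbourhood
of u in Y, which then has at least d|Y| vertices. The degree bound applies to both cases, each
contributing at most ε|U|² pairs. The second application is why ε|V| ≤ d|Y| is required. -/
lemma card_badPairs_le {ε d : ℝ} {V U W Y : Finset α} (hVU : IsSuperRegular G ε d V U)
    (hVW : IsSuperRegular G ε d V W) (hε : 0 < ε) (hd : 0 < d) (hU : 0 < U.card)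
    (hUW : U.card = W.card) (hY : Y ⊆ V) (hYc : ε * V.card ≤ Y.card)
    (hYc' : ε * V.card ≤ d * Y.card) :
    ((badPairs G d U W Y).card : ℝ) ≤ 2 * ε * (U.card : ℝ) ^ 2 := by
  classical
  set B := U.filter fun u ↦ ((Y.filter fun y ↦ G.Adj y u).card : ℝ) < d * Y.card with hB
  let N : α → Finset α := fun u ↦ Y.filter fun y ↦ G.Adj y u
  let Bw : α → Finset α := fun u ↦
    W.filter fun w ↦ (((N u).filter fun y ↦ G.Adj y w).card : ℝ) < d * (N u).card
  have hBc := card_low_degree_le hVU hε hU hY hYc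
  have hsub : badPairs G d U W Y ⊆ B ×ˢ W ∪ (U \ B).biUnion fun u ↦ (Bw u).image (Prod.mk u) := by
    rintro ⟨u, w⟩ hq
    obtain ⟨hm, hlt⟩ := Finset.mem_filter.1 hq
    obtain ⟨hu, hw⟩ := Finset.mem_product.1 hm
    rw [Finset.mem_union]
    by_cases huB : u ∈ B
    · exact Or.inl (Finset.mem_product.2 ⟨huB, hw⟩)
    · refine Or.inr (Finset.mem_biUnion.2 ⟨u, Finset.mem_sdiff.2 ⟨hu, huB⟩,
        Finset.mem_image.2 ⟨w, Finset.mem_filter.2 ⟨hw, ?_⟩, rfl⟩⟩)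
      have hN : d * (Y.card : ℝ) ≤ (N u).card := by
        by_contra! h
        exact huB (Finset.mem_filter.2 ⟨hu, h⟩)
      have e : (N u).filter (fun y ↦ G.Adj y w) = commonNbrs G Y (u, w) := by
        simp only [N, commonNbrs, Finset.filter_filter]
      rw [e]
      calc _ < d ^ 2 * (Y.card : ℝ) := hlt
        _ = d * (d * Y.card) := by ring
        _ ≤ _ := by gcongr
  have hBw : ∀ u ∈ U \ B, (((Bw u).image (Prod.mk u)).card : ℝ) ≤ ε * U.card := by
    intro u hu
    obtain ⟨huU, huB⟩ := Finset.mem_sdiff.1 hu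
    have hN : d * (Y.card : ℝ) ≤ (N u).card := by
      by_contra! h
      exact huB (Finset.mem_filter.2 ⟨huU, h⟩)
    have := card_low_degree_le hVW hε (hUW ▸ hU) ((Finset.filter_subset _ _).trans hY)
      (hYc'.trans hN)
    rw [hUW]
    exact le_trans (by exact_mod_cast Finset.card_image_le) this
  have hcard : ((badPairs G d U W Y).card : ℝ) ≤
      B.card * W.card + ∑ u ∈ U \ B, (((Bw u).image (Prod.mk u)).card : ℝ) := by
    have h1 := (Finset.card_le_card hsub).trans (Finset.card_union_le _ _)
    have h2 := h1.trans (Nat.add_le_add_left Finset.card_biUnion_le _)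
    rw [Finset.card_product] at h2
    exact_mod_cast h2
  calc _ ≤ _ := hcard
    _ ≤ ε * U.card * U.card + ∑ u ∈ U \ B, ε * (U.card : ℝ) := by
      rw [← hUW]
      gcongr with u hu
      exact hBw u hu
    _ = ε * U.card * U.card + ((U \ B).card : ℝ) * (ε * U.card) := by
      rw [Finset.sum_const, nsmul_eq_mul]
    _ ≤ ε * U.card * U.card + (U.card : ℝ) * (ε * U.card) := by
      gcongr
      exact Finset.sdiff_subset
    _ = _ := by ring

end Deterministic

/-! ### Hall's condition and the construction of the factor -/

section Deterministic

variable {α : Type*} [DecidableEq α] {G : SimpleGraph α} [DecidableRel G.Adj]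

/-- Hall's condition from degree conditions on both sides and expansion in the middle range. -/
lemma hall_of_expansion {ι : Type*} [DecidableEq ι] (M : Finset ι) (V : Finset α) (t : ι → Finset α)
    (hMV : M.card = V.card) (htV : ∀ q ∈ M, t q ⊆ V) (a c : ℝ)
    (h₁ : ∀ q ∈ M, a ≤ (t q).card)
    (h₂ : ∀ v ∈ V, c ≤ ((M.filter fun q ↦ v ∈ t q).card : ℝ))
    (h₃ : ∀ X ⊆ M, ∀ Y ⊆ V, a ≤ X.card → c ≤ Y.card → ∃ q ∈ X, ∃ y ∈ Y, y ∈ t q) :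
    ∃ f : {q // q ∈ M} → α, Function.Injective f ∧ ∀ q, f q ∈ t q.1 := by
  classical
  refine (Finset.all_card_le_biUnion_card_iff_exists_injective
    fun q : {q // q ∈ M} ↦ t q.1).1 fun X ↦ ?_
  by_contra! hlt
  set X' : Finset ι := X.image Subtype.val with hX'
  have hX'c : X'.card = X.card := Finset.card_image_of_injective _ Subtype.val_injective
  have hX'M : X' ⊆ M := by
    intro q hq
    obtain ⟨x, -, rfl⟩ := Finset.mem_image.1 hq
    exact x.2
  set N := X.biUnion fun q ↦ t q.1 with hN
  have hNV : N ⊆ V := Finset.biUnion_subset.2 fun q _ ↦ htV q.1 q.2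
  have hXne : X.Nonempty := by
    rw [← Finset.card_pos]; omega
  obtain ⟨q₀, hq₀⟩ := hXne
  -- A violating set is larger than its neighbourhood, hence larger than the degree of any of its
  -- members.
  have hsz : a ≤ (X'.card : ℝ) := by
    have h1 : (t q₀.1).card ≤ N.card :=
      Finset.card_le_card (Finset.subset_biUnion_of_mem (fun q : {q // q ∈ M} ↦ t q.1) hq₀)
    have h2 : ((t q₀.1).card : ℝ) ≤ X'.card := by exact_mod_cast (by omega)
    exact (h₁ q₀.1 q₀.2).trans h2
  have hc1 := Finset.card_sdiff_add_card_eq_card hNV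
  have hc2 := Finset.card_sdiff_add_card_eq_card hX'M
  have hYne : (V \ N).Nonempty := by
    rw [← Finset.card_pos]; omega
  obtain ⟨y, hy⟩ := hYne
  have hyV := (Finset.mem_sdiff.1 hy).1
  -- Dually, a vertex y missed by the violating set has all its neighbours outside that set. So the
  -- missed part of V has at least c vertices as well, and `h₃` yields a forbidden edge.
  have hsub : M.filter (fun q ↦ y ∈ t q) ⊆ M \ X' := by
    intro q hq
    obtain ⟨hqM, hyq⟩ := Finset.mem_filter.1 hq
    refine Finset.mem_sdiff.2 ⟨hqM, fun hqX ↦ (Finset.mem_sdiff.1 hy).2 ?_⟩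
    obtain ⟨x, hx, rfl⟩ := Finset.mem_image.1 hqX
    exact Finset.mem_biUnion.2 ⟨x, hx, hyq⟩
  have hYc : c ≤ ((V \ N).card : ℝ) := by
    have h1 := Finset.card_le_card hsub
    have h2 : ((M.filter fun q ↦ y ∈ t q).card : ℝ) ≤ (V \ N).card := by exact_mod_cast (by omega)
    exact (h₂ y hyV).trans h2
  obtain ⟨q, hq, z, hz, hzq⟩ := h₃ X' hX'M (V \ N) Finset.sdiff_subset hsz hYc
  obtain ⟨x, hx, rfl⟩ := Finset.mem_image.1 hq
  exact (Finset.mem_sdiff.1 hz).2 (Finset.mem_biUnion.2 ⟨x, hx, hzq⟩)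

/-- Few vertices of `V` see few edges of an almost perfect matching. -/
lemma card_low_matching_degree_lt {U V W : Finset α} {d β : ℝ} {n : ℕ} (hd0 : 0 < d) (hd1 : d < 1)
    (hn : 0 < n) (hβ : 0 < β) (M R : Finset (α × α)) (hMU : M ⊆ U ×ˢ W) (hMR : M ⊆ R)
    (hM : 3 / 4 * (n : ℝ) ≤ M.card)
    (hR : ∀ Y ⊆ V, β * n ≤ Y.card → ((R ∩ badPairs G d U W Y).card : ℝ) ≤ d ^ 2 / 4 * n) :
    ((V.filter fun v ↦ ((M.filter fun q ↦ G.Adj v q.1 ∧ G.Adj v q.2).card : ℝ) <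
      d ^ 2 / 2 * n).card : ℝ) < β * n := by
  set Y := V.filter fun v ↦ ((M.filter fun q ↦ G.Adj v q.1 ∧ G.Adj v q.2).card : ℝ) <
      d ^ 2 / 2 * n with hY
  by_contra! hle
  have hn' : (0 : ℝ) < n := by exact_mod_cast hn
  have hYpos : (0 : ℝ) < Y.card := lt_of_lt_of_le (by positivity) hle
  have hYne : Y.Nonempty := by rw [← Finset.card_pos]; exact_mod_cast hYpos
  -- Double counting: at least n/2 edges of M are not bad for Y and each sees d²|Y| of its vertices,
  -- which contradicts the low degrees defining Y.
  have hdbl : ∑ v ∈ Y, (M.filter fun q ↦ G.Adj v q.1 ∧ G.Adj v q.2).card =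
      ∑ q ∈ M, (commonNbrs G Y q).card := by
    simp only [commonNbrs, Finset.card_filter]
    exact Finset.sum_comm
  have hdbl' : ∑ v ∈ Y, ((M.filter fun q ↦ G.Adj v q.1 ∧ G.Adj v q.2).card : ℝ) =
      ∑ q ∈ M, ((commonNbrs G Y q).card : ℝ) := by exact_mod_cast hdbl
  have hup : ∑ v ∈ Y, ((M.filter fun q ↦ G.Adj v q.1 ∧ G.Adj v q.2).card : ℝ) <
      Y.card * (d ^ 2 / 2 * n) := by
    rw [← nsmul_eq_mul, ← Finset.sum_const]
    exact Finset.sum_lt_sum_of_nonempty hYne fun v hv ↦ (Finset.mem_filter.1 hv).2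
  have hbad : ((M ∩ badPairs G d U W Y).card : ℝ) ≤ d ^ 2 / 4 * n :=
    le_trans (by exact_mod_cast Finset.card_le_card (Finset.inter_subset_inter_right hMR))
      (hR Y (Finset.filter_subset _ _) hle)
  have hsplit : ((M \ badPairs G d U W Y).card : ℝ) + (M ∩ badPairs G d U W Y).card = M.card := by
    exact_mod_cast Finset.card_sdiff_add_card_inter M _
  have hlow : ((M \ badPairs G d U W Y).card : ℝ) * (d ^ 2 * Y.card) ≤
      ∑ q ∈ M, ((commonNbrs G Y q).card : ℝ) := by
    rw [← nsmul_eq_mul, ← Finset.sum_const]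
    refine le_trans (Finset.sum_le_sum fun q hq ↦ ?_)
      (Finset.sum_le_sum_of_subset_of_nonneg Finset.sdiff_subset
        fun _ _ _ ↦ Nat.cast_nonneg _)
    obtain ⟨hqM, hqB⟩ := Finset.mem_sdiff.1 hq
    by_contra! h
    exact hqB (Finset.mem_filter.2 ⟨hMU hqM, h⟩)
  have hd2 : d ^ 2 < 1 := by nlinarith
  have hge : (n : ℝ) / 2 ≤ (M \ badPairs G d U W Y).card := by nlinarith
  have := mul_le_mul_of_nonneg_right hge (by positivity : 0 ≤ d ^ 2 * (Y.card : ℝ))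
  rw [hdbl'] at hup
  nlinarith

set_option maxHeartbeats 800000 in
/-- The pseudorandom conditions which suffice for a triangle-factor. -/
lemma containsTriangles_of_pseudorandom {H R : SimpleGraph α} [DecidableRel R.Adj]
    {U V W : Finset α} {d β : ℝ} {n m b : ℕ}
    (hGH : G ≤ H) (hRH : R ≤ H) (hUV : Disjoint U V) (hVW : Disjoint V W) (hUW : Disjoint U W)
    (hVc : V.card = n) (hUc : U.card = m) (hWc : W.card = m) (hnm : n = m + 3 * b)
    (hd0 : 0 < d) (hd1 : d < 1) (hn : 0 < n) (hβ : 0 < β) (hβb : 2 * β * n ≤ b)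
    (hb : (b : ℝ) ≤ d ^ 2 / 60 * n)
    (hdegU : ∀ u ∈ U, d * n ≤ ((V.filter fun v ↦ G.Adj u v).card : ℝ))
    (hdegW : ∀ w ∈ W, d * n ≤ ((V.filter fun v ↦ G.Adj w v).card : ℝ))
    (hdegVU : ∀ v ∈ V, d * m ≤ ((U.filter fun u ↦ G.Adj v u).card : ℝ))
    (hdegVW : ∀ v ∈ V, d * m ≤ ((W.filter fun w ↦ G.Adj v w).card : ℝ))
    (hP₁ : ∀ X ⊆ U, ∀ Z ⊆ W, β * n ≤ X.card → β * n ≤ Z.card →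
      ∃ x ∈ X, ∃ z ∈ Z, R.Adj x z ∧ (x, z) ∉ badPairs G d U W V)
    (hP₂ : ∀ Y ⊆ V, β * n ≤ Y.card →
      (((badPairs G d U W Y).filter fun q ↦ R.Adj q.1 q.2).card : ℝ) ≤ d ^ 2 / 4 * n)
    (hP₃ : ∀ X ⊆ V, β * n ≤ X.card → ∃ x ∈ X, ∃ y ∈ X, H.Adj x y) :
    ContainsTriangles H (m + b) (U ∪ V ∪ W) := by
  classical
  have hn' : (0 : ℝ) < n := by exact_mod_cast hn
  have hnm' : (n : ℝ) = m + 3 * b := by exact_mod_cast hnm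
  have hd2 : d ^ 2 < d := by nlinarith
  have hb1 : (b : ℝ) ≤ n / 60 := by nlinarith
  have hdn : d ^ 2 * (n : ℝ) ≤ d * n := by nlinarith
  have hβn : 0 < β * n := by positivity
  have hdisj {x : α} : ¬ (x ∈ U ∧ x ∈ V) ∧ ¬ (x ∈ V ∧ x ∈ W) ∧ ¬ (x ∈ U ∧ x ∈ W) :=
    ⟨fun h ↦ Finset.disjoint_left.1 hUV h.1 h.2, fun h ↦ Finset.disjoint_left.1 hVW h.1 h.2,
      fun h ↦ Finset.disjoint_left.1 hUW h.1 h.2⟩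
  -- an almost perfect matching of `U` and `W`
  obtain ⟨M, hMs, hMr, hM₁, hM₂, hMc⟩ := exists_large_matching
    (fun x z ↦ R.Adj x z ∧ (x, z) ∉ badPairs G d U W V) U W (hUc.trans hWc.symm) (β * n)
    (fun X hX Z hZ h1 h2 ↦ hP₁ X hX Z hZ h1 h2)
  rw [hUc] at hMc
  have hM34 : 3 / 4 * (n : ℝ) ≤ M.card := by linarith
  -- the vertices seeing few matching edges
  set Y := V.filter fun v ↦ ((M.filter fun q ↦ G.Adj v q.1 ∧ G.Adj v q.2).card : ℝ) <
      d ^ 2 / 2 * n with hYdef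
  have hYV : Y ⊆ V := Finset.filter_subset _ _
  have hYc : (Y.card : ℝ) < β * n := by
    refine card_low_matching_degree_lt hd0 hd1 hn hβ M
      ((U ×ˢ W).filter fun q ↦ R.Adj q.1 q.2) hMs
      (fun q hq ↦ Finset.mem_filter.2 ⟨hMs hq, (hMr q hq).1⟩) hM34 fun Z hZ hZc ↦ ?_
    refine le_trans ?_ (hP₂ Z hZ hZc)
    norm_cast
    refine Finset.card_le_card fun q hq ↦ ?_
    rw [Finset.mem_inter, Finset.mem_filter] at hq
    exact Finset.mem_filter.2 ⟨hq.2, hq.1.2⟩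
  -- cover these vertices
  have sdiff_card (A Z : Finset α) : (A.card : ℝ) - Z.card ≤ (A \ Z).card := by
    have := Finset.le_card_sdiff Z A
    have : (A.card : ℝ) ≤ (A \ Z).card + Z.card := by exact_mod_cast (by omega)
    linarith
  obtain ⟨D₁, hD₁, D₂, hD₂, -, hD₁c, hD₂c, hT₁⟩ := exists_containsTriangles_greedy (H := H) Y U W
    (hUV.symm.mono_left hYV) (hVW.mono_left hYV) (by
      intro v hv Z hZ
      have hZ' : (Z.card : ℝ) ≤ 2 * Y.card := by exact_mod_cast hZ
      -- Even after deleting 2|Y| < 2βn used vertices, both neighbourhoods of v keep βn vertices,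
      -- because 3βn is small compared with d²n/2.
      have hdm : d ^ 2 / 2 * n ≤ d * m := by nlinarith
      obtain ⟨x, hx, z, hz, hxz, -⟩ := hP₁ ((U.filter fun u ↦ G.Adj v u) \ Z)
        (Finset.sdiff_subset.trans (Finset.filter_subset _ _))
        ((W.filter fun u ↦ G.Adj v u) \ Z)
        (Finset.sdiff_subset.trans (Finset.filter_subset _ _))
        (by linarith [sdiff_card (U.filter fun u ↦ G.Adj v u) Z, hdegVU v (hYV hv)])
        (by linarith [sdiff_card (W.filter fun u ↦ G.Adj v u) Z, hdegVW v (hYV hv)])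
      simp only [Finset.mem_sdiff, Finset.mem_filter] at hx hz
      exact ⟨x, Finset.mem_sdiff.2 ⟨hx.1.1, hx.2⟩, z, Finset.mem_sdiff.2 ⟨hz.1.1, hz.2⟩,
        SimpleGraph.is3Clique_triple_iff.2 ⟨hGH hx.1.2, hGH hz.1.2, hRH hxz⟩⟩)
  -- trim the matching
  set M₂ := M.filter fun q ↦ q.1 ∉ D₁ ∧ q.2 ∉ D₂ with hM₂def
  have hM₂c : M.card ≤ M₂.card + 2 * Y.card := by
    have hsub : M ⊆ M₂ ∪ ((M.filter fun q ↦ q.1 ∈ D₁) ∪ (M.filter fun q ↦ q.2 ∈ D₂)) := by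
      intro q hq
      simp only [hM₂def, Finset.mem_union, Finset.mem_filter]
      tauto
    have h1 : (M.filter fun q ↦ q.1 ∈ D₁).card ≤ D₁.card :=
      Finset.card_le_card_of_injOn Prod.fst (fun q hq ↦ (Finset.mem_filter.1 hq).2)
        (hM₁.mono (Finset.coe_subset.2 (Finset.filter_subset _ _)))
    have h2 : (M.filter fun q ↦ q.2 ∈ D₂).card ≤ D₂.card :=
      Finset.card_le_card_of_injOn Prod.snd (fun q hq ↦ (Finset.mem_filter.1 hq).2)
        (hM₂.mono (Finset.coe_subset.2 (Finset.filter_subset _ _)))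
    have h3 := (Finset.card_le_card hsub).trans (Finset.card_union_le _ _)
    have h4 := Finset.card_union_le (M.filter fun q ↦ q.1 ∈ D₁) (M.filter fun q ↦ q.2 ∈ D₂)
    omega
  have hM₂c' : (M.card : ℝ) ≤ M₂.card + 2 * Y.card := by exact_mod_cast hM₂c
  -- M misses fewer than βn vertices of U and trimming loses at most 2|Y| edges, so 2βn ≤ b leaves
  -- enough edges for a submatching of size m - b - |Y|. With this size, exactly b vertices remain
  -- on each side.
  have hsize : m ≤ M₂.card + b + Y.card := by
    have : (m : ℝ) ≤ M₂.card + b + Y.card := by linarith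
    exact_mod_cast this
  have hbY : b + Y.card ≤ m := by
    have : (b : ℝ) + Y.card ≤ m := by linarith
    exact_mod_cast this
  obtain ⟨M₃, hM₃s, hM₃c⟩ := Finset.exists_subset_card_eq (s := M₂) (n := m - b - Y.card) (by omega)
  have hM₃M : M₃ ⊆ M := hM₃s.trans (Finset.filter_subset _ _)
  have hinj₁ : Set.InjOn Prod.fst (M₃ : Set (α × α)) := hM₁.mono (Finset.coe_subset.2 hM₃M)
  have hinj₂ : Set.InjOn Prod.snd (M₃ : Set (α × α)) := hM₂.mono (Finset.coe_subset.2 hM₃M)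
  -- cover the unmatched vertices of `U` and `W`
  have rest (A D : Finset α) (φ : α × α → α) (hφ : Set.InjOn φ (M₃ : Set (α × α)))
      (hA : A.card = m) (hD : D ⊆ A) (hDc : D.card = Y.card) (hφA : ∀ q ∈ M₃, φ q ∈ A)
      (hφD : ∀ q ∈ M₃, φ q ∉ D) : (A \ (D ∪ M₃.image φ)).card = b := by
    rw [Finset.card_sdiff_of_subset (Finset.union_subset hD (Finset.image_subset_iff.2 hφA)),
      Finset.card_union_of_disjoint, Finset.card_image_of_injOn hφ]
    · omega
    · rw [Finset.disjoint_right]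
      intro x hx
      obtain ⟨q, hq, rfl⟩ := Finset.mem_image.1 hx
      exact hφD q hq
  have hM₃U : ∀ q ∈ M₃, q.1 ∈ U := fun q hq ↦ (Finset.mem_product.1 (hMs (hM₃M hq))).1
  have hM₃W : ∀ q ∈ M₃, q.2 ∈ W := fun q hq ↦ (Finset.mem_product.1 (hMs (hM₃M hq))).2
  have hM₃D₁ : ∀ q ∈ M₃, q.1 ∉ D₁ := fun q hq ↦ (Finset.mem_filter.1 (hM₃s hq)).2.1
  have hM₃D₂ : ∀ q ∈ M₃, q.2 ∉ D₂ := fun q hq ↦ (Finset.mem_filter.1 (hM₃s hq)).2.2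
  set U' := U \ (D₁ ∪ M₃.image Prod.fst) with hU'
  set W' := W \ (D₂ ∪ M₃.image Prod.snd) with hW'
  have hU'c : U'.card = b := rest U D₁ Prod.fst hinj₁ hUc hD₁ hD₁c hM₃U hM₃D₁
  have hW'c : W'.card = b := rest W D₂ Prod.snd hinj₂ hWc hD₂ hD₂c hM₃W hM₃D₂
  have hU'U : U' ⊆ U := Finset.sdiff_subset
  have hW'W : W' ⊆ W := Finset.sdiff_subset
  have hIc : (U' ∪ W').card = 2 * b := by
    rw [Finset.card_union_of_disjoint (hUW.mono hU'U hW'W)]; omega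
  have hIV : Disjoint (U' ∪ W') (V \ Y) := by
    rw [Finset.disjoint_union_left]
    exact ⟨hUV.mono hU'U Finset.sdiff_subset, (hVW.mono_left Finset.sdiff_subset).symm.mono_left hW'W⟩
  obtain ⟨E₁, hE₁, E₂, hE₂, hE, hE₁c, hE₂c, hT₂⟩ := exists_containsTriangles_greedy (H := H)
    (U' ∪ W') (V \ Y) (V \ Y) hIV hIV (by
      intro i hi Z hZ
      rw [hIc] at hZ
      have hZ' : (Z.card : ℝ) ≤ 2 * (2 * b) := by exact_mod_cast hZ
      have hdeg : d * n ≤ ((V.filter fun v ↦ G.Adj i v).card : ℝ) := by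
        rcases Finset.mem_union.1 hi with h | h
        · exact hdegU i (hU'U h)
        · exact hdegW i (hW'W h)
      obtain ⟨x, hx, y, hy, hxy⟩ := hP₃ (((V.filter fun v ↦ G.Adj i v) \ Y) \ Z)
        (Finset.sdiff_subset.trans (Finset.sdiff_subset.trans (Finset.filter_subset _ _)))
        (by linarith [sdiff_card (V.filter fun v ↦ G.Adj i v) Y,
          sdiff_card ((V.filter fun v ↦ G.Adj i v) \ Y) Z])
      simp only [Finset.mem_sdiff, Finset.mem_filter] at hx hy
      refine ⟨x, ?_, y, ?_, SimpleGraph.is3Clique_triple_iff.2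
        ⟨hGH hx.1.1.2, hGH hy.1.1.2, hxy⟩⟩ <;> simp only [Finset.mem_sdiff] <;> tauto)
  rw [hIc] at hE₁c hE₂c hT₂
  -- match the rest by Hall's theorem
  set V' := (V \ Y) \ (E₁ ∪ E₂) with hV'
  have hV'V : V' ⊆ V := Finset.sdiff_subset.trans Finset.sdiff_subset
  have hEc : (E₁ ∪ E₂).card = 4 * b := by
    rw [Finset.card_union_of_disjoint hE]; omega
  -- The balance n - |Y| - 4b = m - b - |Y| follows from n = m + 3b.
  have hV'c : V'.card = m - b - Y.card := by
    rw [hV', Finset.card_sdiff_of_subset (Finset.union_subset hE₁ hE₂),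
      Finset.card_sdiff_of_subset hYV]
    omega
  have hM₃c' : (M₃.card : ℝ) + b + Y.card = m := by
    have : M₃.card + b + Y.card = m := by omega
    exact_mod_cast this
  have hMm : (M.card : ℝ) ≤ m := by
    rw [← hUc]
    exact_mod_cast Finset.card_le_card_of_injOn Prod.fst
      (fun q hq ↦ (Finset.mem_product.1 (hMs hq)).1) hM₁
  -- Edges of M keep at least d²n - |Y| - 4b common neighbours, and vertices outside Y lose at most
  -- b + |Y| matching edges. A set of d²n/2 matching edges exceeds the d²n/4 edges of R that can be
  -- bad for Z, so one of them has a common neighbour in Z.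
  obtain ⟨f, hf, hft⟩ := hall_of_expansion M₃ V' (fun q ↦ commonNbrs G V' q)
    (hM₃c.trans hV'c.symm) (fun q _ ↦ Finset.filter_subset _ _) (d ^ 2 / 2 * n) (d ^ 2 / 4 * n)
    (by
      intro q hq
      have h1 : d ^ 2 * n ≤ ((commonNbrs G V q).card : ℝ) := by
        by_contra! h
        refine (hMr q (hM₃M hq)).2 (Finset.mem_filter.2 ⟨hMs (hM₃M hq), ?_⟩)
        rw [hVc]; exact h
      have h2 : (commonNbrs G V q \ Y) \ (E₁ ∪ E₂) ⊆ commonNbrs G V' q := by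
        intro v hv
        simp only [commonNbrs, hV', Finset.mem_sdiff, Finset.mem_filter] at hv ⊢
        tauto
      have h3 : (((commonNbrs G V q \ Y) \ (E₁ ∪ E₂)).card : ℝ) ≤ (commonNbrs G V' q).card := by
        exact_mod_cast Finset.card_le_card h2
      have h4 : ((E₁ ∪ E₂).card : ℝ) = 4 * b := by exact_mod_cast hEc
      linarith [sdiff_card (commonNbrs G V q) Y, sdiff_card (commonNbrs G V q \ Y) (E₁ ∪ E₂)])
    (by
      intro v hv
      have hvY : v ∉ Y := (Finset.mem_sdiff.1 (Finset.mem_sdiff.1 hv).1).2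
      have h1 : d ^ 2 / 2 * n ≤
          ((M.filter fun q ↦ G.Adj v q.1 ∧ G.Adj v q.2).card : ℝ) := by
        by_contra! h
        exact hvY (Finset.mem_filter.2 ⟨hV'V hv, h⟩)
      have h2 : M.filter (fun q ↦ G.Adj v q.1 ∧ G.Adj v q.2) ⊆
          M₃.filter (fun q ↦ v ∈ commonNbrs G V' q) ∪ (M \ M₃) := by
        intro q hq
        simp only [commonNbrs, Finset.mem_sdiff, Finset.mem_filter, Finset.mem_union] at hq ⊢
        tauto
      have h3 : ((M.filter fun q ↦ G.Adj v q.1 ∧ G.Adj v q.2).card : ℝ) ≤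
          (M₃.filter (fun q ↦ v ∈ commonNbrs G V' q)).card + (M \ M₃).card := by
        exact_mod_cast (Finset.card_le_card h2).trans (Finset.card_union_le _ _)
      have h4 : ((M \ M₃).card : ℝ) + M₃.card = M.card := by
        exact_mod_cast Finset.card_sdiff_add_card_eq_card hM₃M
      linarith)
    (by
      intro X hX Z hZ hXc hZc
      have hZβ : β * n ≤ Z.card := by nlinarith
      have hbad := hP₂ Z (hZ.trans hV'V) hZβ
      have : ∃ q ∈ X, q ∉ (badPairs G d U W Z).filter fun q ↦ R.Adj q.1 q.2 := by
        by_contra! h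
        have h1 : (X.card : ℝ) ≤ ((badPairs G d U W Z).filter fun q ↦ R.Adj q.1 q.2).card := by
          exact_mod_cast Finset.card_le_card h
        have : 0 < d ^ 2 * n := by positivity
        linarith
      obtain ⟨q, hq, hqb⟩ := this
      have h1 : d ^ 2 * Z.card ≤ ((commonNbrs G Z q).card : ℝ) := by
        by_contra! h
        exact hqb (Finset.mem_filter.2 ⟨Finset.mem_filter.2 ⟨hMs (hM₃M (hX hq)), h⟩,
          (hMr q (hM₃M (hX hq))).1⟩)
      have h2 : (0 : ℝ) < (commonNbrs G Z q).card :=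
        lt_of_lt_of_le (mul_pos (by positivity) (hβn.trans_le hZβ)) h1
      obtain ⟨y, hy⟩ := Finset.card_pos.1 (by exact_mod_cast h2 : 0 < (commonNbrs G Z q).card)
      obtain ⟨hyZ, hyq⟩ := Finset.mem_filter.1 hy
      exact ⟨q, hq, y, hyZ, Finset.mem_filter.2 ⟨hZ hyZ, hyq⟩⟩)
  have hfV : ∀ q, f q ∈ V' := fun q ↦ (Finset.mem_filter.1 (hft q)).1
  have hT₃ := containsTriangles_biUnion (H := H) M₃.attach (fun q ↦ {f q, q.1.1, q.1.2})
    (fun q _ ↦ SimpleGraph.is3Clique_triple_iff.2 ⟨hGH (Finset.mem_filter.1 (hft q)).2.1,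
      hGH (Finset.mem_filter.1 (hft q)).2.2, hRH (hMr q.1 (hM₃M q.2)).1⟩)
    (by
      intro q _ q' _ hne
      have hne' : q.1 ≠ q'.1 := fun h ↦ hne (Subtype.ext h)
      have e1 : f q ≠ f q' := fun h ↦ hne (hf h)
      have e2 : q.1.1 ≠ q'.1.1 := fun h ↦ hne' (hinj₁ q.2 q'.2 h)
      have e3 : q.1.2 ≠ q'.1.2 := fun h ↦ hne' (hinj₂ q.2 q'.2 h)
      have a1 := hV'V (hfV q)
      have a2 := hV'V (hfV q')
      have a3 := hM₃U q.1 q.2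
      have a4 := hM₃U q'.1 q'.2
      have a5 := hM₃W q.1 q.2
      have a6 := hM₃W q'.1 q'.2
      simp only [Finset.disjoint_insert_left, Finset.disjoint_singleton_left, Finset.mem_insert,
        Finset.mem_singleton, not_or]
      refine ⟨⟨e1, ?_, ?_⟩, ⟨?_, e2, ?_⟩, ?_, ?_, e3⟩
      · intro h; rw [h] at a1; exact hdisj.1 ⟨a4, a1⟩
      · intro h; rw [h] at a1; exact hdisj.2.1 ⟨a1, a6⟩
      · intro h; rw [h] at a3; exact hdisj.1 ⟨a3, a2⟩
      · intro h; rw [h] at a3; exact hdisj.2.2 ⟨a3, a6⟩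
      · intro h; rw [h] at a5; exact hdisj.2.1 ⟨a2, a5⟩
      · intro h; rw [h] at a5; exact hdisj.2.2 ⟨a4, a5⟩)
  rw [Finset.card_attach, hM₃c] at hT₃
  have hT₃' := hT₃.mono (S' := V' ∪ (M₃.image Prod.fst ∪ M₃.image Prod.snd)) (by
    refine Finset.biUnion_subset.2 fun q _ ↦ ?_
    intro x hx
    simp only [Finset.mem_insert, Finset.mem_singleton] at hx
    rcases hx with rfl | rfl | rfl
    · exact Finset.mem_union_left _ (hfV q)
    · exact Finset.mem_union_right _ (Finset.mem_union_left _ (Finset.mem_image_of_mem _ q.2))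
    · exact Finset.mem_union_right _ (Finset.mem_union_right _ (Finset.mem_image_of_mem _ q.2)))
  have hI₁ : M₃.image Prod.fst ⊆ U := Finset.image_subset_iff.2 hM₃U
  have hI₂ : M₃.image Prod.snd ⊆ W := Finset.image_subset_iff.2 hM₃W
  have hI₁D : Disjoint D₁ (M₃.image Prod.fst) := by
    rw [Finset.disjoint_right]
    intro x hx
    obtain ⟨q, hq, rfl⟩ := Finset.mem_image.1 hx
    exact hM₃D₁ q hq
  have hI₂D : Disjoint D₂ (M₃.image Prod.snd) := by
    rw [Finset.disjoint_right]
    intro x hx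
    obtain ⟨q, hq, rfl⟩ := Finset.mem_image.1 hx
    exact hM₃D₂ q hq
  have hE₁V := hE₁.trans Finset.sdiff_subset
  have hE₂V := hE₂.trans Finset.sdiff_subset
  have hYE : Disjoint Y (V \ Y) := Finset.disjoint_sdiff
  have hEV' : Disjoint (E₁ ∪ E₂) V' := Finset.disjoint_sdiff
  have hEV'₁ := hEV'.mono_left Finset.subset_union_left
  have hEV'₂ := hEV'.mono_left Finset.subset_union_right
  have hDU' : Disjoint (D₁ ∪ M₃.image Prod.fst) U' := Finset.disjoint_sdiff
  have hDW' : Disjoint (D₂ ∪ M₃.image Prod.snd) W' := Finset.disjoint_sdiff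
  have h12 := hT₁.union hT₂ (by
    simp only [Finset.disjoint_union_left]
    simp only [Finset.disjoint_union_right]
    exact ⟨⟨⟨hUV.symm.mono hYV hU'U, hVW.mono hYV hW'W⟩, hYE.mono_right hE₁, hYE.mono_right hE₂⟩,
      ⟨⟨hDU'.mono_left Finset.subset_union_left, hUW.mono hD₁ hW'W⟩, hUV.mono hD₁ hE₁V,
        hUV.mono hD₁ hE₂V⟩,
      ⟨hUW.symm.mono hD₂ hU'U, hDW'.mono_left Finset.subset_union_left⟩, hVW.symm.mono hD₂ hE₁V,
        hVW.symm.mono hD₂ hE₂V⟩)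
  have h123 := h12.union hT₃' (by
    simp only [Finset.disjoint_union_left]
    simp only [Finset.disjoint_union_right]
    exact ⟨⟨⟨hYE.mono_right Finset.sdiff_subset, hUV.symm.mono hYV hI₁, hVW.mono hYV hI₂⟩,
      ⟨hUV.mono hD₁ hV'V, hI₁D, hUW.mono hD₁ hI₂⟩,
      hVW.symm.mono hD₂ hV'V, hUW.symm.mono hD₂ hI₁, hI₂D⟩,
      ⟨⟨hUV.mono hU'U hV'V, (hDU'.mono_left Finset.subset_union_right).symm,
        hUW.mono hU'U hI₂⟩, hVW.symm.mono hW'W hV'V, hUW.symm.mono hW'W hI₁,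
        (hDW'.mono_left Finset.subset_union_right).symm⟩,
      ⟨hEV'₁, hUV.symm.mono hE₁V hI₁, hVW.mono hE₁V hI₂⟩,
      hEV'₂, hUV.symm.mono hE₂V hI₁, hVW.mono hE₂V hI₂⟩)
  have hk : Y.card + 2 * b + (m - b - Y.card) = m + b := by omega
  rw [hk] at h123
  have iU : U ⊆ U ∪ V ∪ W := Finset.subset_union_left.trans Finset.subset_union_left
  have iV : V ⊆ U ∪ V ∪ W := Finset.subset_union_right.trans Finset.subset_union_left
  have iW : W ⊆ U ∪ V ∪ W := Finset.subset_union_right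
  refine h123.mono ?_
  simp only [Finset.union_subset_iff]
  exact ⟨⟨⟨hYV.trans iV, hD₁.trans iU, hD₂.trans iW⟩, ⟨hU'U.trans iU, hW'W.trans iW⟩,
    hE₁V.trans iV, hE₂V.trans iV⟩, hV'V.trans iV, hI₁.trans iU, hI₂.trans iW⟩

end Deterministic

/-! ### Random graphs: union bounds for the pseudorandom properties -/

section RandomGraph

variable {α : Type*}

lemma mk_mem_edgeSet_completeBetween {U W : Finset α} (hUW : Disjoint U W) {q : α × α}
    (hq : q ∈ U ×ˢ W) : s(q.1, q.2) ∈ (completeBetween U W).edgeSet := by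
  obtain ⟨h1, h2⟩ := Finset.mem_product.1 hq
  rw [SimpleGraph.mem_edgeSet, completeBetween, SimpleGraph.fromRel_adj]
  exact ⟨fun h ↦ Finset.disjoint_left.1 hUW h1 (h ▸ h2), Or.inl ⟨h1, h2⟩⟩

lemma injOn_mk_product {U W : Finset α} (hUW : Disjoint U W) :
    Set.InjOn (fun q : α × α ↦ s(q.1, q.2)) (U ×ˢ W : Finset (α × α)) := by
  intro q hq q' hq' h
  obtain ⟨h1, h2⟩ := Finset.mem_product.1 (Finset.mem_coe.1 hq)
  obtain ⟨h3, h4⟩ := Finset.mem_product.1 (Finset.mem_coe.1 hq')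
  rcases Sym2.eq_iff.1 h with ⟨e1, e2⟩ | ⟨e1, e2⟩
  · exact Prod.ext e1 e2
  · exact absurd (e1 ▸ h1) fun h ↦ Finset.disjoint_left.1 hUW h h4

variable [Finite α]

/-- A graph is determined by its edge set, so every family of graphs is a preimage under a
measurable map into a finite space. -/
lemma measurableSet_graph_of_finite (A : Set (SimpleGraph α)) : MeasurableSet A := by
  rw [← Set.preimage_image_eq A SimpleGraph.edgeSet_injective]
  exact SimpleGraph.measurable_edgeSet (measurableSet_of_finite _)

instance (H : SimpleGraph α) (p : unitInterval) : IsProbabilityMeasure (randomSubgraph H p) :=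
  Measure.isProbabilityMeasure_map SimpleGraph.measurable_fromEdgeSet.aemeasurable

lemma randomSubgraph_real_apply (H : SimpleGraph α) (p : unitInterval) (A : Set (SimpleGraph α)) :
    (randomSubgraph H p).real A =
      (setBernoulli H.edgeSet p).real {s | SimpleGraph.fromEdgeSet s ∈ A} :=
  map_measureReal_apply SimpleGraph.measurable_fromEdgeSet (measurableSet_graph_of_finite A)

/-- An increasing graph property is more likely at a larger density. -/
lemma randomSubgraph_real_mono (H : SimpleGraph α) {p q : unitInterval} (hqp : q ≤ p)
    {A : Set (SimpleGraph α)} (hA : ∀ R ∈ A, ∀ R', R ≤ R' → R' ∈ A) :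
    (randomSubgraph H q).real A ≤ (randomSubgraph H p).real A := by
  rw [randomSubgraph_real_apply, randomSubgraph_real_apply]
  exact setBernoulli_real_mono _ hqp fun s hs t hst ↦
    hA _ hs _ (SimpleGraph.fromEdgeSet_mono hst)

variable [DecidableEq α]

/-- Every large vertex set contains an edge of `R`. -/
def NoLargeIndependent (R : SimpleGraph α) (V : Finset α) (b : ℝ) : Prop :=
  ∀ X ⊆ V, b ≤ X.card → ∃ x ∈ X, ∃ y ∈ X, R.Adj x y

/-- Any two large sets span an edge of `R` outside `B`. -/
def NoLargeHole (R : SimpleGraph α) (U W : Finset α) (B : Finset (α × α)) (b : ℝ) : Prop :=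
  ∀ X ⊆ U, ∀ Z ⊆ W, b ≤ X.card → b ≤ Z.card → ∃ x ∈ X, ∃ z ∈ Z, R.Adj x z ∧ (x, z) ∉ B

/-- For every large `Y`, at most `K` pairs of `B Y` are edges of `R`. -/
def FewEdgesIn (R : SimpleGraph α) (V : Finset α) (B : Finset α → Finset (α × α)) (b K : ℝ) :
    Prop :=
  ∀ Y ⊆ V, b ≤ Y.card → ∀ T ⊆ B Y, (∀ q ∈ T, R.Adj q.1 q.2) → (T.card : ℝ) ≤ K

/-- Union bound over subsets of V. The condition 2 ≤ b gives x(x - 1)/2 ≥ b²/4 for x ≥ b, so each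
large set contains at least b²/4 potential edges. -/
lemma randomOn_real_not_noLargeIndependent_le (V : Finset α) (p : unitInterval) {b : ℝ}
    (hb : 2 ≤ b) : (randomOn V p).real {R | ¬ NoLargeIndependent R V b} ≤
      2 ^ V.card * Real.exp (-(p * (b ^ 2 / 4))) := by
  classical
  rw [randomOn, randomSubgraph_real_apply]
  have hsub : {s | SimpleGraph.fromEdgeSet s ∈ {R | ¬ NoLargeIndependent R V b}} ⊆
      ⋃ X ∈ V.powerset.filter (fun X ↦ b ≤ X.card),
        {s : Set (Sym2 α) | ∀ e ∈ X.offDiag.image Sym2.mk.uncurry, e ∉ s} := by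
    intro s hs
    simp only [NoLargeIndependent, Set.mem_ofPred_eq, not_forall] at hs
    obtain ⟨X, hX, hXb, h⟩ := hs
    simp only [Set.mem_iUnion]
    refine ⟨X, Finset.mem_filter.2 ⟨Finset.mem_powerset.2 hX, hXb⟩, fun e he hes ↦ h ?_⟩
    obtain ⟨⟨x, y⟩, hxy, rfl⟩ := Finset.mem_image.1 he
    obtain ⟨hx, hy, hne⟩ := Finset.mem_offDiag.1 hxy
    exact ⟨x, hx, y, hy, (SimpleGraph.fromEdgeSet_adj s).2 (And.intro hes hne)⟩
  calc _ ≤ _ := measureReal_mono hsub (measure_ne_top _ _)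
    _ ≤ _ := measureReal_biUnion_finset_le _ _
    _ ≤ ∑ X ∈ V.powerset.filter (fun X ↦ b ≤ X.card), Real.exp (-(p * (b ^ 2 / 4))) := by
      refine Finset.sum_le_sum fun X hX ↦ ?_
      obtain ⟨hXV, hXb⟩ := Finset.mem_filter.1 hX
      refine (setBernoulli_real_disjoint_le p ?_).trans ?_
      · intro e he
        obtain ⟨⟨x, y⟩, hxy, rfl⟩ := Finset.mem_image.1 (Finset.mem_coe.1 he)
        obtain ⟨hx, hy, hne⟩ := Finset.mem_offDiag.1 hxy
        have hXV' := Finset.mem_powerset.1 hXV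
        change (completeOn V).Adj x y
        rw [completeOn, SimpleGraph.fromRel_adj]
        exact ⟨hne, Or.inl ⟨hXV' hx, hXV' hy⟩⟩
      · have hp := p.2.1
        gcongr
        have : (X.offDiag.image Sym2.mk.uncurry).card = X.card.choose 2 :=
          Sym2.card_image_offDiag X
        rw [this, Nat.cast_choose_two]
        nlinarith
    _ ≤ _ := by
      rw [Finset.sum_const, nsmul_eq_mul]
      gcongr
      exact_mod_cast (Finset.card_filter_le _ _).trans (Finset.card_powerset V).le

/-- Removing B costs at most half of the b² pairs between two large sets, so b²/2 independent
potential edges would all have to be absent. -/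
lemma randomBetween_real_not_noLargeHole_le {U W : Finset α} (hUW : Disjoint U W)
    (p : unitInterval) {b : ℝ} (hb : 0 ≤ b) (B : Finset (α × α)) (hB : (B.card : ℝ) ≤ b ^ 2 / 2) :
    (randomBetween U W p).real {R | ¬ NoLargeHole R U W B b} ≤
      2 ^ U.card * 2 ^ W.card * Real.exp (-(p * (b ^ 2 / 2))) := by
  classical
  rw [randomBetween, randomSubgraph_real_apply]
  let φ : α × α → Sym2 α := fun q ↦ s(q.1, q.2)
  have hsub : {s | SimpleGraph.fromEdgeSet s ∈ {R | ¬ NoLargeHole R U W B b}} ⊆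
      ⋃ P ∈ (U.powerset ×ˢ W.powerset).filter (fun P ↦ b ≤ P.1.card ∧ b ≤ P.2.card),
        {s : Set (Sym2 α) | ∀ e ∈ ((P.1 ×ˢ P.2) \ B).image φ, e ∉ s} := by
    intro s hs
    simp only [NoLargeHole, Set.mem_ofPred_eq, not_forall] at hs
    obtain ⟨X, hX, Z, hZ, hXb, hZb, h⟩ := hs
    simp only [Set.mem_iUnion]
    refine ⟨(X, Z), Finset.mem_filter.2 ⟨Finset.mem_product.2 ⟨Finset.mem_powerset.2 hX,
      Finset.mem_powerset.2 hZ⟩, hXb, hZb⟩, fun e he hes ↦ h ?_⟩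
    obtain ⟨⟨x, z⟩, hxz, rfl⟩ := Finset.mem_image.1 he
    obtain ⟨hm, hnB⟩ := Finset.mem_sdiff.1 hxz
    obtain ⟨hx, hz⟩ : x ∈ X ∧ z ∈ Z := Finset.mem_product.1 hm
    exact ⟨x, hx, z, hz, (SimpleGraph.fromEdgeSet_adj _).2 ⟨hes, fun e ↦
      Finset.disjoint_left.1 hUW (hX hx) (e ▸ hZ hz)⟩, hnB⟩
  calc _ ≤ _ := measureReal_mono hsub (measure_ne_top _ _)
    _ ≤ _ := measureReal_biUnion_finset_le _ _
    _ ≤ ∑ P ∈ (U.powerset ×ˢ W.powerset).filter (fun P ↦ b ≤ P.1.card ∧ b ≤ P.2.card),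
        Real.exp (-(p * (b ^ 2 / 2))) := by
      refine Finset.sum_le_sum fun P hP ↦ ?_
      obtain ⟨hPm, hP1, hP2⟩ := Finset.mem_filter.1 hP
      obtain ⟨hPU, hPW⟩ := Finset.mem_product.1 hPm
      have hPs : (P.1 ×ˢ P.2) \ B ⊆ U ×ˢ W := Finset.sdiff_subset.trans
        (Finset.product_subset_product (Finset.mem_powerset.1 hPU) (Finset.mem_powerset.1 hPW))
      refine (setBernoulli_real_disjoint_le p ?_).trans ?_
      · intro e he
        obtain ⟨q, hq, rfl⟩ := Finset.mem_image.1 (Finset.mem_coe.1 he)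
        exact mk_mem_edgeSet_completeBetween hUW (hPs hq)
      · have hp := p.2.1
        gcongr
        rw [Finset.card_image_of_injOn ((injOn_mk_product hUW).mono (Finset.coe_subset.2 hPs))]
        have h1 : P.1.card * P.2.card ≤ ((P.1 ×ˢ P.2) \ B).card + B.card := by
          have := Finset.le_card_sdiff B (P.1 ×ˢ P.2)
          rw [Finset.card_product] at this
          omega
        have h2 : (P.1.card : ℝ) * P.2.card ≤ ((P.1 ×ˢ P.2) \ B).card + B.card := by
          exact_mod_cast h1
        have h3 : b * b ≤ (P.1.card : ℝ) * P.2.card := by gcongr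
        nlinarith
    _ ≤ _ := by
      rw [Finset.sum_const, nsmul_eq_mul]
      gcongr
      have := Finset.card_filter_le (U.powerset ×ˢ W.powerset)
        (fun P ↦ b ≤ P.1.card ∧ b ≤ P.2.card)
      rw [Finset.card_product, Finset.card_powerset, Finset.card_powerset] at this
      exact_mod_cast this

/-- Union bound over Y of the upper tail for the number of random edges among at most L pairs. The
parameter t is left free, to be taken large when L is a small multiple of n². -/
lemma randomBetween_real_not_fewEdgesIn_le {U W : Finset α} (hUW : Disjoint U W)
    (p : unitInterval) (V : Finset α) (B : Finset α → Finset (α × α)) {b K L t : ℝ} (ht : 0 < t)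
    (hBs : ∀ Y, B Y ⊆ U ×ˢ W) (hB : ∀ Y ⊆ V, b ≤ Y.card → ((B Y).card : ℝ) ≤ L) :
    (randomBetween U W p).real {R | ¬ FewEdgesIn R V B b K} ≤
      2 ^ V.card * (Real.exp (L * p * t) / t ^ ⌈K⌉₊) := by
  classical
  rw [randomBetween, randomSubgraph_real_apply]
  let φ : α × α → Sym2 α := fun q ↦ s(q.1, q.2)
  have hsub : {s | SimpleGraph.fromEdgeSet s ∈ {R | ¬ FewEdgesIn R V B b K}} ⊆
      ⋃ Y ∈ V.powerset.filter (fun Y ↦ b ≤ Y.card),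
        {s : Set (Sym2 α) | ∃ T ⊆ B Y, T.card = ⌈K⌉₊ ∧ ∀ q ∈ T, φ q ∈ s} := by
    intro s hs
    simp only [FewEdgesIn, Set.mem_ofPred_eq, not_forall, not_le] at hs
    obtain ⟨Y, hY, hYb, T, hT, hTs, hK⟩ := hs
    simp only [Set.mem_iUnion]
    obtain ⟨T', hT', hc⟩ := Finset.exists_subset_card_eq (Nat.ceil_le.2 hK.le)
    exact ⟨Y, Finset.mem_filter.2 ⟨Finset.mem_powerset.2 hY, hYb⟩, T', hT'.trans hT, hc,
      fun q hq ↦ ((SimpleGraph.fromEdgeSet_adj _).1 (hTs q (hT' hq))).1⟩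
  calc _ ≤ _ := measureReal_mono hsub (measure_ne_top _ _)
    _ ≤ _ := measureReal_biUnion_finset_le _ _
    _ ≤ ∑ Y ∈ V.powerset.filter (fun Y ↦ b ≤ Y.card),
        Real.exp (L * p * t) / t ^ ⌈K⌉₊ := by
      refine Finset.sum_le_sum fun Y hY ↦ ?_
      obtain ⟨hYV, hYb⟩ := Finset.mem_filter.1 hY
      refine (setBernoulli_real_card_ge_le p (B Y) φ
        ((injOn_mk_product hUW).mono (Finset.coe_subset.2 (hBs Y)))
        (fun q hq ↦ mk_mem_edgeSet_completeBetween hUW (hBs Y hq)) _ ht).trans ?_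
      have hp := p.2.1
      have := hB Y (Finset.mem_powerset.1 hYV) hYb
      gcongr
    _ ≤ _ := by
      rw [Finset.sum_const, nsmul_eq_mul]
      gcongr
      exact_mod_cast (Finset.card_filter_le _ _).trans (Finset.card_powerset V).le

end RandomGraph

/-! ### Choice of densities and probability estimates -/

lemma two_pow_le_exp (n : ℕ) : (2 : ℝ) ^ n ≤ Real.exp n := by
  rw [← Real.exp_one_pow]
  gcongr
  linarith [Real.add_one_le_exp (1 : ℝ)]

/-- The random bipartite graph contains, with high probability, a pseudorandom subgraph. -/
lemma randomBetween_real_exists_pseudorandom_ge {α : Type*} [Finite α] [DecidableEq α]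
    {U V W : Finset α} (hUW : Disjoint U W) {p : unitInterval} {n m : ℕ}
    (hV : V.card = n) (hU : U.card = m) (hW : W.card = m) (hmn : m ≤ n) {β κ ε C : ℝ} (hn : 0 < n)
    (hβ : 0 < β) (hκ : 0 < κ) (hC : C = 12 / β ^ 2) (hε0 : 0 < ε)
    (hε : 2 * ε * C * Real.exp (4 / κ) ≤ 1)
    (hCn : C ≤ n) (hCp : C / n ≤ p) (B : Finset α → Finset (α × α)) (hBs : ∀ Y, B Y ⊆ U ×ˢ W)
    (hB : ∀ Y ⊆ V, β * n ≤ Y.card → ((B Y).card : ℝ) ≤ 2 * ε * (m : ℝ) ^ 2)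
    (hβV : β * n ≤ V.card) :
    1 - 2 * Real.exp (-n) ≤ (randomBetween U W p).real
      {R | ∃ R' ≤ R, NoLargeHole R' U W (B V) (β * n) ∧ FewEdgesIn R' V B (β * n) (κ * n)} := by
  have hn' : (0 : ℝ) < n := by exact_mod_cast hn
  have hmn' : (m : ℝ) ≤ n := by exact_mod_cast hmn
  have hC0 : 0 < C := by rw [hC]; positivity
  have hCβ : C * β ^ 2 = 12 := by rw [hC]; field_simp
  let q : unitInterval := ⟨C / n, by positivity, by rw [div_le_one hn']; exact hCn⟩
  have hq : (q : ℝ) = C / n := rfl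
  have hB' : ∀ Y ⊆ V, β * n ≤ Y.card → ((B Y).card : ℝ) ≤ 2 * ε * (n : ℝ) ^ 2 := fun Y hY hYc ↦
    (hB Y hY hYc).trans (by gcongr)
  have h4 : (1 : ℝ) ≤ Real.exp (4 / κ) := Real.one_le_exp (by positivity)
  -- Bad pairs for V fill at most half of any product of two sets of size βn.
  have hεβ : 2 * ε ≤ β ^ 2 / 2 := by
    have h1 : 2 * ε * C ≤ 1 := le_trans (le_mul_of_one_le_right (by positivity) h4) hε
    have h2 : 2 * ε * C * β ^ 2 ≤ 1 * β ^ 2 := by gcongr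
    nlinarith
  have e1 : (randomBetween U W q).real {R | ¬ NoLargeHole R U W (B V) (β * n)} ≤
      Real.exp (-n) := by
    refine (randomBetween_real_not_noLargeHole_le hUW q (by positivity) (B V)
      ((hB' V subset_rfl hβV).trans ?_)).trans ?_
    · nlinarith [sq_nonneg (n : ℝ)]
    · have h1 : (q : ℝ) * ((β * n) ^ 2 / 2) = 6 * n := by
        rw [hq]; field_simp; linarith
      rw [h1, hU, hW]
      calc (2 : ℝ) ^ m * 2 ^ m * Real.exp (-(6 * n))
          ≤ Real.exp n * Real.exp n * Real.exp (-(6 * n)) := by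
            have : (2 : ℝ) ^ m ≤ Real.exp n := (two_pow_le_exp m).trans (Real.exp_le_exp.2 hmn')
            gcongr
        _ ≤ _ := by
          rw [← Real.exp_add, ← Real.exp_add]
          exact Real.exp_le_exp.2 (by linarith)
  have e2 : (randomBetween U W q).real {R | ¬ FewEdgesIn R V B (β * n) (κ * n)} ≤
      Real.exp (-n) := by
    -- With t = exp(4/κ) the factor t^(κn) equals exp(4n). It beats exp(n) from the union bound and
    -- exp(n) from the mean, where the smallness of ε enters.
    refine (randomBetween_real_not_fewEdgesIn_le hUW q V B (Real.exp_pos (4 / κ)) hBs hB').trans ?_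
    rw [hV, ← Real.exp_nat_mul, ← Real.exp_sub]
    calc _ ≤ Real.exp n * Real.exp ((n : ℝ) - (4 : ℝ) * n) := by
          have h1 : κ * n ≤ ⌈κ * n⌉₊ := Nat.le_ceil _
          have h2 : 4 * (n : ℝ) ≤ ⌈κ * n⌉₊ * (4 / κ) := by
            calc 4 * (n : ℝ) = κ * n * (4 / κ) := by field_simp
              _ ≤ _ := by gcongr
          gcongr ?_ * Real.exp (?_ - ?_)
          · exact two_pow_le_exp n
          · have : 2 * ε * (n : ℝ) ^ 2 * q * Real.exp (4 / κ) =
              (2 * ε * C * Real.exp (4 / κ)) * n := by rw [hq]; field_simp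
            rw [this]
            nlinarith
      _ ≤ _ := by
        rw [← Real.exp_add]
        exact Real.exp_le_exp.2 (by linarith)
  have hgood : 1 - 2 * Real.exp (-n) ≤ (randomBetween U W q).real
      {R | ∃ R' ≤ R, NoLargeHole R' U W (B V) (β * n) ∧ FewEdgesIn R' V B (β * n) (κ * n)} := by
    set A := {R | ∃ R' ≤ R, NoLargeHole R' U W (B V) (β * n) ∧
      FewEdgesIn R' V B (β * n) (κ * n)} with hA
    have hsub : Aᶜ ⊆ {R | ¬ NoLargeHole R U W (B V) (β * n)} ∪
        {R | ¬ FewEdgesIn R V B (β * n) (κ * n)} := by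
      intro R hR
      by_contra h
      simp only [Set.mem_union, Set.mem_ofPred_eq, not_or, not_not] at h
      exact hR ⟨R, le_rfl, h.1, h.2⟩
    have : IsProbabilityMeasure (randomBetween U W q) :=
      inferInstanceAs (IsProbabilityMeasure (randomSubgraph _ q))
    have h1 := (measureReal_mono hsub (measure_ne_top (randomBetween U W q) _)).trans
      (measureReal_union_le _ _)
    rw [probReal_compl_eq_one_sub (measurableSet_graph_of_finite A)] at h1
    linarith
  -- Having a pseudorandom subgraph is an increasing property, so the estimate at density C/n
  -- transfers to p.
  refine hgood.trans (randomSubgraph_real_mono _ (q := q) (p := p) hCp ?_)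
  rintro R ⟨R', hR', h⟩ R'' hR''
  exact ⟨R', hR'.trans hR'', h⟩

lemma randomOn_real_noLargeIndependent_ge {α : Type*} [Finite α] [DecidableEq α]
    {V : Finset α} {p : unitInterval} {n : ℕ} (hV : V.card = n) {β C : ℝ} (hn : 0 < n)
    (hβ : 0 < β) (hC : C = 12 / β ^ 2) (hβn : 2 ≤ β * n) (hCp : C / n ≤ p) :
    1 - Real.exp (-n) ≤ (randomOn V p).real {R | NoLargeIndependent R V (β * n)} := by
  have hn' : (0 : ℝ) < n := by exact_mod_cast hn
  have hCβ : C * β ^ 2 = 12 := by rw [hC]; field_simp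
  have e : (randomOn V p).real {R | ¬ NoLargeIndependent R V (β * n)} ≤ Real.exp (-n) := by
    refine (randomOn_real_not_noLargeIndependent_le V p hβn).trans ?_
    have h1 : 3 * n ≤ (p : ℝ) * ((β * n) ^ 2 / 4) := by
      calc 3 * (n : ℝ) = C / n * ((β * n) ^ 2 / 4) := by field_simp; linarith
        _ ≤ _ := by gcongr
    rw [hV]
    calc _ ≤ Real.exp n * Real.exp (-(3 * n)) := by
          gcongr
          exact two_pow_le_exp n
      _ ≤ _ := by
        rw [← Real.exp_add]
        exact Real.exp_le_exp.2 (by linarith)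
  have : IsProbabilityMeasure (randomOn V p) :=
    inferInstanceAs (IsProbabilityMeasure (randomSubgraph _ p))
  have h2 := probReal_compl_eq_one_sub (μ := randomOn V p)
    (measurableSet_graph_of_finite {R | NoLargeIndependent R V (β * n)})
  rw [Set.compl_ofPred] at h2
  linarith

/-- The deterministic core of the theorem for super-regular pairs and pseudorandom graphs. -/
lemma hasTriangleFactor_of_pseudorandom {α : Type*} [Fintype α] [DecidableEq α]
    {G R₁ R₂ : SimpleGraph α} [DecidableRel G.Adj] {U V W : Finset α} {d ε β : ℝ} {n m b : ℕ}
    (hUV : Disjoint U V) (hVW : Disjoint V W) (hUW : Disjoint U W)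
    (huniv : U ∪ V ∪ W = Finset.univ)
    (hVc : V.card = n) (hUc : U.card = m) (hWc : W.card = m) (hnm : n = m + 3 * b)
    (hd0 : 0 < d) (hd1 : d < 1) (hn : 0 < n) (hβ : 0 < β) (hβb : 2 * β * n ≤ b)
    (hb : (b : ℝ) ≤ d ^ 2 / 60 * n)
    (hGU : IsSuperRegular G ε d V U) (hGW : IsSuperRegular G ε d V W)
    (h₁ : NoLargeIndependent R₁ V (β * n))
    (h₂ : ∃ R ≤ R₂, NoLargeHole R U W (badPairs G d U W V) (β * n) ∧
      FewEdgesIn R V (badPairs G d U W) (β * n) (d ^ 2 / 4 * n)) :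
    HasTriangleFactor (G ⊔ R₁ ⊔ R₂) := by
  classical
  obtain ⟨R, hR, hole, few⟩ := h₂
  have hT := containsTriangles_of_pseudorandom (G := G) (H := G ⊔ R₁ ⊔ R₂) (R := R)
    (le_sup_left.trans le_sup_left) (hR.trans le_sup_right) hUV hVW hUW hVc hUc hWc hnm hd0 hd1 hn
    hβ hβb hb (fun u hu ↦ hVc ▸ hGU.2.2 u hu) (fun w hw ↦ hVc ▸ hGW.2.2 w hw)
    (fun v hv ↦ hUc ▸ hGU.2.1 v hv) (fun v hv ↦ hWc ▸ hGW.2.1 v hv) hole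
    (fun Y hY hYc ↦ few Y hY hYc _ (Finset.filter_subset _ _)
      fun q hq ↦ (Finset.mem_filter.1 hq).2)
    (fun X hX hXc ↦ by
      obtain ⟨x, hx, y, hy, hxy⟩ := h₁ X hX hXc
      exact ⟨x, hx, y, hy, Or.inl (Or.inr hxy)⟩)
  refine hT.hasTriangleFactor ?_
  have hc : Fintype.card α = U.card + V.card + W.card := by
    rw [← Finset.card_univ, ← huniv, Finset.card_union_of_disjoint
      (Finset.disjoint_union_left.2 ⟨hUW, hVW⟩), Finset.card_union_of_disjoint hUV]
  omega

end TriangleFactor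

/-! ### The main theorem: choice of constants and conclusion -/

theorem mainTheorem7 (δ' d : ℝ) (hδ' : 0 < δ') (hδ'd : δ' ≤ d) (hd : d < 1) :
    ∃ δ₀ δ ε C : ℝ, δ₀ ≤ δ' ∧ δ < δ₀ ∧ ε < δ ∧ 0 < ε ∧ 0 < C ∧
      -- "asymptotically almost surely", uniformly over all admissible inputs with `|V| = n`
      ∀ η : ℝ, 0 < η → ∃ N : ℕ, ∀ n : ℕ, N ≤ n →
        ∀ (α : Type*) [Fintype α] [DecidableEq α] (G : SimpleGraph α) [DecidableRel G.Adj]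
          (U V W : Finset α) (p : unitInterval),
          Disjoint U V → Disjoint V W → Disjoint U W → U ∪ V ∪ W = Finset.univ →
          V.card = n → U.card = W.card →
          (1 - δ₀) * (n : ℝ) ≤ (U.card : ℝ) → (U.card : ℝ) ≤ (1 - δ) * (n : ℝ) →
          3 ∣ U.card + V.card + W.card →
          TriangleFactor.IsSuperRegular G ε d V U →
          TriangleFactor.IsSuperRegular G ε d V W →
          C / (n : ℝ) ≤ (p : ℝ) →
          1 - η ≤ ((TriangleFactor.randomOn V p).prod (TriangleFactor.randomBetween U W p)).real
            {R | TriangleFactor.HasTriangleFactor (G ⊔ R.1 ⊔ R.2)} := by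
  have hd0 : 0 < d := hδ'.trans_le hδ'd
  -- As 3b = n - |U| lies between δ₀n/2 and δ₀n, the bound d²/20 gives b ≤ d²n/60, and β = δ₀/12
  -- gives 2βn ≤ b. The 12 in C makes the exponents Cβ²n/2 and Cβ²n/4 equal to 6n and 3n. Finally ε
  -- ≤ dβ keeps regularity available for neighbourhoods inside sets of size βn.
  obtain ⟨δ₀, hδ₀⟩ : ∃ x, x = min δ' (d ^ 2 / 20) := ⟨_, rfl⟩
  have hδ₀δ' : δ₀ ≤ δ' := hδ₀ ▸ min_le_left _ _
  have hδ₀d : δ₀ ≤ d ^ 2 / 20 := hδ₀ ▸ min_le_right _ _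
  have hδ₀pos : 0 < δ₀ := hδ₀ ▸ lt_min hδ' (by positivity)
  obtain ⟨β, hβdef⟩ : ∃ x, x = δ₀ / 12 := ⟨_, rfl⟩
  have hβ : 0 < β := by rw [hβdef]; positivity
  obtain ⟨C, hC⟩ : ∃ x, x = 12 / β ^ 2 := ⟨_, rfl⟩
  have hCpos : 0 < C := by rw [hC]; positivity
  obtain ⟨ε, hεdef⟩ : ∃ x, x = min (1 / (2 * C * Real.exp (4 / (d ^ 2 / 4)))) (d * β) := ⟨_, rfl⟩
  have hε0 : 0 < ε := hεdef ▸ lt_min (by positivity) (by positivity)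
  have hεβ : ε ≤ d * β := hεdef ▸ min_le_right _ _
  have hεC : 2 * ε * C * Real.exp (4 / (d ^ 2 / 4)) ≤ 1 := by
    have : ε ≤ 1 / (2 * C * Real.exp (4 / (d ^ 2 / 4))) := hεdef ▸ min_le_left _ _
    rw [le_div_iff₀ (by positivity)] at this
    linarith
  have hdβ : d * β < β := by nlinarith
  have hd2 : d ^ 2 < 1 := by nlinarith
  have hβ1 : β < 1 := by linarith
  refine ⟨δ₀, δ₀ / 2, ε, C, hδ₀δ', by linarith, by linarith, hε0, hCpos, fun η hη ↦ ?_⟩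
  -- The summands ensure in turn βn ≥ 2, C/n ≤ 1 and 3exp(-n) ≤ η.
  obtain ⟨N, hN⟩ := exists_nat_ge (2 / β + C + 3 / η + 1)
  refine ⟨N, fun n hNn α _ _ G _ U V W p hUV hVW hUW huniv hVc hUWc hUl hUu h3 hGU hGW hCp ↦ ?_⟩
  have hnN : 2 / β + C + 3 / η + 1 ≤ (n : ℝ) := hN.trans (by exact_mod_cast hNn)
  have p1 : 0 < 2 / β := by positivity
  have p2 : 0 < 3 / η := by positivity
  have hn' : (0 : ℝ) < n := by linarith
  have hn : 0 < n := by exact_mod_cast hn'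
  have hβn : 2 ≤ β * n := by
    rw [mul_comm, ← div_le_iff₀ hβ]; linarith
  have hUn : U.card ≤ n := by
    have : (U.card : ℝ) ≤ n := hUu.trans (mul_le_of_le_one_left hn'.le (by linarith))
    exact_mod_cast this
  -- The division is exact: 3 divides n + 2|U|, hence also n - |U|.
  obtain ⟨b, hb⟩ : ∃ b, n = U.card + 3 * b := ⟨(n - U.card) / 3, by omega⟩
  have hb' : (n : ℝ) = U.card + 3 * b := by exact_mod_cast hb
  have hβb : 2 * β * n ≤ b := by rw [hβdef]; linarith
  have hbn : (b : ℝ) ≤ d ^ 2 / 60 * n := by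
    have := mul_le_mul_of_nonneg_right hδ₀d hn'.le
    linarith
  have hUpos : 0 < U.card := by
    have : (0 : ℝ) < U.card := lt_of_lt_of_le (mul_pos (by linarith) hn') hUl
    exact_mod_cast this
  have hbad : ∀ Y ⊆ V, β * n ≤ Y.card →
      ((TriangleFactor.badPairs G d U W Y).card : ℝ) ≤ 2 * ε * (U.card : ℝ) ^ 2 := by
    intro Y hY hYc
    refine TriangleFactor.card_badPairs_le hGU hGW hε0 hd0 hUpos hUWc hY ?_ ?_
    · rw [hVc]
      exact le_trans (by gcongr; linarith) hYc
    · rw [hVc]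
      calc ε * n ≤ d * β * n := by gcongr
        _ = d * (β * n) := by ring
        _ ≤ _ := by gcongr
  have hA₂ := TriangleFactor.randomBetween_real_exists_pseudorandom_ge hUW hVc rfl hUWc.symm hUn hn
    hβ (by positivity : 0 < d ^ 2 / 4) hC hε0 hεC (by linarith) hCp
    (TriangleFactor.badPairs G d U W) (fun Y ↦ Finset.filter_subset _ _) hbad
    (by rw [hVc]; exact mul_le_of_le_one_left hn'.le hβ1.le)
  have hA₁ := TriangleFactor.randomOn_real_noLargeIndependent_ge hVc hn hβ hC hβn hCp
  set A₁ := {R | TriangleFactor.NoLargeIndependent R V (β * n)}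
  set A₂ := {R | ∃ R' ≤ R, TriangleFactor.NoLargeHole R' U W
    (TriangleFactor.badPairs G d U W V) (β * n) ∧
      TriangleFactor.FewEdgesIn R' V (TriangleFactor.badPairs G d U W) (β * n) (d ^ 2 / 4 * n)}
  have : IsProbabilityMeasure (TriangleFactor.randomOn V p) :=
    inferInstanceAs (IsProbabilityMeasure (TriangleFactor.randomSubgraph _ p))
  have : IsProbabilityMeasure (TriangleFactor.randomBetween U W p) :=
    inferInstanceAs (IsProbabilityMeasure (TriangleFactor.randomSubgraph _ p))
  have hsub : A₁ ×ˢ A₂ ⊆ {R | TriangleFactor.HasTriangleFactor (G ⊔ R.1 ⊔ R.2)} := by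
    rintro ⟨R₁, R₂⟩ ⟨h₁, h₂⟩
    exact TriangleFactor.hasTriangleFactor_of_pseudorandom hUV hVW hUW huniv hVc rfl hUWc.symm hb
      hd0 hd hn hβ hβb hbn hGU hGW h₁ h₂
  have hmain := measureReal_mono hsub (measure_ne_top
    ((TriangleFactor.randomOn V p).prod (TriangleFactor.randomBetween U W p)) _)
  rw [measureReal_prod_prod] at hmain
  have hexp : 3 * Real.exp (-n) ≤ η := by
    rw [Real.exp_neg, ← div_eq_mul_inv, div_le_iff₀ (Real.exp_pos _)]
    have h1 : 3 / η ≤ n := by linarith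
    rw [div_le_iff₀ hη] at h1
    have h2 := Real.add_one_le_exp (n : ℝ)
    have h3' := mul_le_mul_of_nonneg_left h2 hη.le
    linarith
  have q1 : (TriangleFactor.randomOn V p).real A₁ ≤ 1 := measureReal_le_one
  have q2 : (TriangleFactor.randomBetween U W p).real A₂ ≤ 1 := measureReal_le_one
  refine le_trans ?_ hmain
  -- Expanding (1 - x)(1 - y) ≥ 0 gives xy ≥ x + y - 1 ≥ 1 - 3exp(-n) for the two probabilities.
  linarith [mul_nonneg (sub_nonneg.2 q1) (sub_nonneg.2 q2)]
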